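/- **Notation.** Let $J_{st}=\begin{pmatrix}0&-I_n\\ I_n&0\end{pmatrix}$ on $\mathbb{R}^{2n}$, and let $\|\cdot\|$ be the Euclidean norm and $\|\cdot\|_0$ the associated operator norm of matrices. For a domain (connected open set) $D$, a map is of class $\mathcal{C}^k$ on $\bar D$ if it is $\mathcal{C}^k$ on $D$ and all its derivatives of order at most $k$ extend continuously to $\bar D$; derivatives at boundary points are these extensions. An almost complex structure on $D$ is here a matrix-valued map $J$ of class $\mathcal{C}^1$ on $\bar D$ with $J^2=-I_{2n}$. For a matrix-valued map $H$ of class $\mathcal{C}^1$ on $\bar D$, with $D$ bounded, put $$\|H\|_{\mathcal{C}^1(\bar D)}=\max_{p\in\bar D}\Big(\|H(p)\|_0+\Big(\sum_{i=1}^{2n}\Big\|\Big(\frac{\partial H_{i,j}}{\partial x_k}(p)\Big)_{j,k}\Big\|_0^2\Big)^{1/2}\Big).$$ For a real function $u$ of class $\mathcal{C}^2$ on $\bar D$, the Levi form is $\mathcal{L}^J_xu(X)=d(d^c_Ju)_x(X,J(x)X)$, where $d^c_Ju(X)=-du(JX)$ and $d\alpha(X,Y)=(D_X\alpha)(Y)-(D_Y\alpha)(X)$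 for a one-form $\alpha$. Put $$\lambda_0(D,J,u)=\min\{\mathcal{L}^J_xu(X) : x\in\bar D,\ \|X\|=1\};$$ $u$ is strictly $J$-plurisubharmonic on $D$ if $\lambda_0(D,J,u)>0$. Let $\Delta$ be the open unit disc of $\mathbb{C}$. A $J$-holomorphic disc in $D$ is a $\mathcal{C}^1$ map $h:\Delta\to D$ with $dh_\zeta(iw)=J(h(\zeta))\,dh_\zeta(w)$ for all $\zeta\in\Delta$, $w\in\mathbb{C}$. For $p\in D$ and $v\in\mathbb{R}^{2n}$, the Kobayashi–Royden pseudometric is $$K_{(D,J)}(p,v)=\inf\{\alpha>0 : \text{there is a } J\text{-holomorphic disc } h \text{ in } D \text{ with } h(0)=p,\ \tfrac{\partial h}{\partial x}(0)=v/\alpha\}.$$ **Proposition.** There exist universal constants $c'>0$ and $\varepsilon'>0$ (independent of $n$, $D$, $J$, $u$, $t$, $p$, $v$) such that the following holds. Let $D$ be a domain in the unit ball of $\mathbb{R}^{2n}$, $J$ an almost complex structure on $D$ with $\|J-J_{st}\|_{\mathcal{C}^1(\bar D)}\le\varepsilon'$, and $u$ a function of class $\mathcal{C}^2$ on $\bar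 D$ that is negative on $D$ and strictly $J$-plurisubharmonic on $D$. If $\|x\|\le t$ for all $x\in D$, then $$K_{(D,J)}(p,v)\ \ge\ c'\,e^{-2t}\,\sqrt{\lambda_0(D,J,u)}\,\frac{\|v\|}{\sqrt{|u(p)|}}\qquad\text{for all } p\in D,\ v\in\mathbb{R}^{2n}.$$ -/

import Mathlib

noncomputable section

namespace AlmostComplex

/-- The Euclidean space `ℝ²ⁿ`, with coordinates `(x₁, …, xₙ, y₁, …, yₙ)`. -/
abbrev E (n : ℕ) : Type := EuclideanSpace ℝ (Fin n ⊕ Fin n)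

/-- The standard complex structure, with matrix `(0, -Iₙ; Iₙ, 0)`. -/
def Jst (n : ℕ) : E n →L[ℝ] E n :=
  Matrix.toEuclideanCLM (𝕜 := ℝ) (Matrix.J (Fin n) ℝ)

/-- `f` is of class `C^k` on the closure of the open set `D`: it is of class `C^k` on `D`, and all
its derivatives of order at most `k` extend continuously from `D` to the closure of `D`. In
particular this holds when `f` is of class `C^k` on a neighbourhood of the closure of `D`. -/
def ContDiffOnClosure {V W : Type*} [NormedAddCommGroup V] [NormedSpace ℝ V]
    [NormedAddCommGroup W] [NormedSpace ℝ W] (k : ℕ) (f : V → W) (D : Set V) : Prop :=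
  ContDiffOn ℝ k f D ∧
    ∀ m : ℕ, m ≤ k → ∃ g : V → ContinuousMultilinearMap ℝ (fun _ : Fin m => V) W,
      ContinuousOn g (closure D) ∧ Set.EqOn g (iteratedFDeriv ℝ m f) D

/-- `J` is an almost complex structure on `D`, of class `C¹` up to the boundary. -/
structure IsAlmostComplexOn {n : ℕ} (J : E n → (E n →L[ℝ] E n)) (D : Set (E n)) : Prop where
  contDiff : ContDiffOnClosure 1 J D
  sq_eq : ∀ x ∈ D, ∀ X : E n, J x (J x X) = -X

/-- The matrix `(∂Hᵢⱼ/∂xₖ (p))_{j,k}`, where `Hᵢⱼ` are the entries of the matrix of `H`. -/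
def derivMatrix {n : ℕ} (H : E n → (E n →L[ℝ] E n)) (p : E n) (i : Fin n ⊕ Fin n) :
    Matrix (Fin n ⊕ Fin n) (Fin n ⊕ Fin n) ℝ :=
  Matrix.of fun j k =>
    fderiv ℝ (fun x => (H x (EuclideanSpace.single j 1)) i) p (EuclideanSpace.single k 1)

/-- The pointwise norm `‖H_p‖₁ = ‖H_p‖₀ + (∑ᵢ ‖(∂Hᵢⱼ/∂xₖ (p))_{j,k}‖₀²)^{1/2}`, where `‖·‖₀` is the
operator norm with respect to the Euclidean norm. -/
def pointNorm {n : ℕ} (H : E n → (E n →L[ℝ] E n)) (p : E n) : ℝ :=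
  ‖H p‖ + √(∑ i, ‖Matrix.toEuclideanCLM (𝕜 := ℝ) (derivMatrix H p i)‖ ^ 2)

/-- The `C¹` norm of `H` on the closure of `D`. For `H` of class `C¹` on the closure of a bounded
`D`, the maximum over the closure is the supremum over `D`, by continuity. -/
def normC1 {n : ℕ} (D : Set (E n)) (H : E n → (E n →L[ℝ] E n)) : ℝ :=
  sSup (pointNorm H '' D)

/-- The one-form `d^c_J u`, defined by `d^c_J u (X) = -du (J X)`. -/
def dc {n : ℕ} (J : E n → (E n →L[ℝ] E n)) (u : E n → ℝ) (x : E n) : E n →L[ℝ] ℝ :=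
  -(fderiv ℝ u x).comp (J x)

/-- The Levi form `L^J_x u (X) = d(d^c_J u)_x (X, J X)`, where the exterior derivative of a
one-form `α` is `dα_x (X, Y) = (D_X α)_x (Y) - (D_Y α)_x (X)`. -/
def levi {n : ℕ} (J : E n → (E n →L[ℝ] E n)) (u : E n → ℝ) (x X : E n) : ℝ :=
  fderiv ℝ (dc J u) x X (J x X) - fderiv ℝ (dc J u) x (J x X) X

/-- `λ₀(D, J, u)`, the lowest eigenvalue of the Levi form. For `J` of class `C¹` and `u` of class
`C²` on the closure of a bounded `D`, the minimum of `L^J_x u (X)` over `x` in the closure of `D`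
and unit vectors `X` is the infimum over `x ∈ D` and unit vectors `X`, by continuity. -/
def lambda0 {n : ℕ} (D : Set (E n)) (J : E n → (E n →L[ℝ] E n)) (u : E n → ℝ) : ℝ :=
  sInf {r : ℝ | ∃ x ∈ D, ∃ X : E n, ‖X‖ = 1 ∧ r = levi J u x X}

/-- `u` is strictly `J`-plurisubharmonic on `D`. -/
def StrictlyPsh {n : ℕ} (D : Set (E n)) (J : E n → (E n →L[ℝ] E n)) (u : E n → ℝ) : Prop :=
  0 < lambda0 D J u

/-- `h` is a `J`-holomorphic disc in `D`: a `C¹` map from the open unit disc of `ℂ` to `D` whose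
differential intertwines multiplication by `i` and `J`. -/
structure IsHolDisc {n : ℕ} (D : Set (E n)) (J : E n → (E n →L[ℝ] E n)) (h : ℂ → E n) :
    Prop where
  contDiffOn : ContDiffOn ℝ 1 h (Metric.ball 0 1)
  mapsTo : Set.MapsTo h (Metric.ball 0 1) D
  hol : ∀ ζ ∈ Metric.ball (0 : ℂ) 1, ∀ w : ℂ,
    fderiv ℝ h ζ (Complex.I * w) = J (h ζ) (fderiv ℝ h ζ w)

/-- The Kobayashi–Royden pseudometric `K_{(D,J)}(p, v)`: the infimum, in `[0, ∞]`, of the `α > 0`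
for which some `J`-holomorphic disc `h` in `D` has `h(0) = p` and `∂h/∂x (0) = v / α`. -/
def kobayashi {n : ℕ} (D : Set (E n)) (J : E n → (E n →L[ℝ] E n)) (p v : E n) : ENNReal :=
  sInf {a : ENNReal | ∃ α : ℝ, 0 < α ∧ a = ENNReal.ofReal α ∧
    ∃ h : ℂ → E n, IsHolDisc D J h ∧ h 0 = p ∧ fderiv ℝ h 0 1 = α⁻¹ • v}

end AlmostComplex

end

noncomputable section

open MeasureTheory Metric Set Filter Topology Complex

namespace AlmostComplex

/-! ### Circle integrals and Stokes' theorem for `C¹` maps. -/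

section CircleCalculus

/-! Let `h` be a `J`-holomorphic disc with `h 0 = p`. Everything reduces to a universal bound
`‖∂h/∂x(0)‖² ≤ C |u(p)| / λ₀`. The factor `e^{-2t}` is at most 1 and needs no argument of its own.

Flux bounds area. Along the disc the pull-back of `d(d^c u)` dominates `λ₀` times the energy
density, so by Stokes the flux of `d^c u` through the circle of radius `r` dominates `λ₀` times the
area inside. That flux is `r` times the derivative of the circle integral of `u ∘ h`, and it
increases with `r`; since `u < 0`, it is at most `4π|u(p)|` for `r < 1/2` (`formIntegral_dc_le`).

Area bounds the derivative. Let `A` be the symplectic area for `Jst`, and `η` the relative defect in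
the Cauchy–Riemann equations for `Jst`. The sharp isoperimetric inequality, obtained from
Wirtinger's, gives `2A ≤ (1 + 7η) r A'`. A small constant `η` only makes `A / r` increasing; a
defect `η ≤ L r` makes `e^{14 L r} A / r²` increasing, whence `‖∂f/∂x(0)‖² ≤ C A(r) / r²`
(`norm_sq_mul_le_area`). A linearly vanishing defect is produced by conjugating `J(h(0))` to `Jst`
with `straighten`, but `L` is then a bound for the derivative of the disc, so the radius must be of
order `1/L`.

The gradient is bounded a priori. At a point chosen so that the derivative nearby is at most twice
its value `R` there, the area at scale `1/R` is bounded below by a constant. Linear decay and the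
absolute bound `A ≤ 2π` for discs in the unit ball bound it above. Hence `R` is controlled
(`IsHolDisc.norm_fderiv_le`), the radius can be taken universal, and the two estimates combine in
`IsHolDisc.norm_sq_le`. -/

theorem continuous_slice {W : Type*} [TopologicalSpace W] {k : ℝ → ℝ → W} {d : ℝ}
    (hk : ContinuousOn (fun q : ℝ × ℝ => k q.1 q.2) {q | |q.1| < d}) {s : ℝ} (hs : |s| < d) :
    Continuous (k s) :=
  hk.comp_continuous (f := fun θ : ℝ => (s, θ)) (by fun_prop) (fun _ => hs)

/-- Differentiation under the integral sign of a product whose first factor vanishes at the base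
point: the second factor only has to be continuous. -/
theorem hasDerivAt_integral_bilin {W₁ W₂ : Type*} [NormedAddCommGroup W₁] [NormedSpace ℝ W₁]
    [NormedAddCommGroup W₂] [NormedSpace ℝ W₂] (B : W₁ →L[ℝ] W₂ →L[ℝ] ℝ)
    {g g' : ℝ → ℝ → W₁} {b : ℝ → ℝ → W₂} {d r : ℝ} (hr : |r| < d)
    (hg : ∀ s θ, |s| < d → HasDerivAt (fun t => g t θ) (g' s θ) s)
    (hgc : ContinuousOn (fun q : ℝ × ℝ => g q.1 q.2) {q | |q.1| < d})
    (hg'c : ContinuousOn (fun q : ℝ × ℝ => g' q.1 q.2) {q | |q.1| < d})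
    (hbc : ContinuousOn (fun q : ℝ × ℝ => b q.1 q.2) {q | |q.1| < d}) :
    HasDerivAt (fun s => ∫ θ in (0 : ℝ)..2 * Real.pi, B (g s θ - g r θ) (b s θ))
      (∫ θ in (0 : ℝ)..2 * Real.pi, B (g' r θ) (b r θ)) r := by
  obtain ⟨δ, hδ0, hδ⟩ : ∃ δ > 0, |r| + δ < d := ⟨(d - |r|) / 2, by linarith, by linarith⟩
  have hs_lt : ∀ s ∈ closedBall r δ, |s| < d := by
    intro s hs
    rw [mem_closedBall, Real.dist_eq] at hs
    have := abs_sub_abs_le_abs_sub s r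
    linarith
  have hK : IsCompact (closedBall r δ ×ˢ Icc (0 : ℝ) (2 * Real.pi)) :=
    (isCompact_closedBall r δ).prod isCompact_Icc
  have hKs : closedBall r δ ×ˢ Icc (0 : ℝ) (2 * Real.pi) ⊆ {q : ℝ × ℝ | |q.1| < d} :=
    fun q hq => hs_lt q.1 hq.1
  obtain ⟨C₁, hC₁⟩ := hK.exists_bound_of_continuousOn (hg'c.mono hKs)
  obtain ⟨C₂, hC₂⟩ := hK.exists_bound_of_continuousOn (hbc.mono hKs)
  have hrm : r ∈ closedBall r δ := mem_closedBall_self hδ0.le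
  have hpi : (0 : ℝ) ≤ 2 * Real.pi := by positivity
  have hC₁0 : 0 ≤ C₁ := (norm_nonneg _).trans (hC₁ (r, 0) ⟨hrm, ⟨le_rfl, hpi⟩⟩)
  have hcont : ∀ s ∈ closedBall r δ, Continuous (fun θ => B (g s θ - g r θ) (b s θ)) := by
    intro s hs
    have h1 := continuous_slice hgc (hs_lt s hs)
    have h2 := continuous_slice hgc hr
    have h3 := continuous_slice hbc (hs_lt s hs)
    fun_prop
  have hcont' : Continuous (fun θ => B (g' r θ) (b r θ)) := by
    have h1 := continuous_slice hg'c hr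
    have h3 := continuous_slice hbc hr
    fun_prop
  simp only [intervalIntegral.integral_of_le hpi]
  -- Only a Lipschitz bound based at `r` is required. The integrand vanishes at `s = r`, so the mean
  -- value inequality for `g` and a bound for `b` suffice.
  have key := hasFDerivAt_integral_of_dominated_loc_of_lip' (𝕜 := ℝ)
    (μ := volume.restrict (Ioc (0 : ℝ) (2 * Real.pi)))
    (F := fun s θ => B (g s θ - g r θ) (b s θ))
    (F' := fun θ => ContinuousLinearMap.toSpanSingleton ℝ (B (g' r θ) (b r θ)))
    (x₀ := r) (bound := fun _ => ‖B‖ * C₁ * C₂) (closedBall_mem_nhds r hδ0)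
    (fun s hs => (hcont s hs).aestronglyMeasurable)
    (((hcont r hrm).intervalIntegrable 0 (2 * Real.pi)).1)
    (by
      have : Continuous fun θ => ContinuousLinearMap.toSpanSingleton ℝ (B (g' r θ) (b r θ)) :=
        (ContinuousLinearMap.toSpanSingletonCLE (𝕜 := ℝ) (E := ℝ)).continuous.comp hcont'
      exact this.aestronglyMeasurable)
    (by
      refine (ae_restrict_iff' measurableSet_Ioc).2 (Eventually.of_forall ?_)
      intro θ hθ s hs
      have hθ' : θ ∈ Icc (0 : ℝ) (2 * Real.pi) := ⟨hθ.1.le, hθ.2⟩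
      have h1 : ‖g s θ - g r θ‖ ≤ C₁ * ‖s - r‖ :=
        (convex_closedBall r δ).norm_image_sub_le_of_norm_hasDerivWithin_le
          (fun x hx => (hg x θ (hs_lt x hx)).hasDerivWithinAt)
          (fun x hx => hC₁ (x, θ) ⟨hx, hθ'⟩) hrm hs
      have h2 : ‖b s θ‖ ≤ C₂ := hC₂ (s, θ) ⟨hs, hθ'⟩
      simp only [sub_self, map_zero, zero_apply, sub_zero]
      calc ‖B (g s θ - g r θ) (b s θ)‖ ≤ ‖B‖ * ‖g s θ - g r θ‖ * ‖b s θ‖ := B.le_opNorm₂ _ _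
        _ ≤ ‖B‖ * (C₁ * ‖s - r‖) * C₂ := by gcongr
        _ = ‖B‖ * C₁ * C₂ * ‖s - r‖ := by ring)
    (integrable_const _)
    (by
      refine Eventually.of_forall fun θ => ?_
      refine HasDerivAt.hasFDerivAt ?_
      rw [hasDerivAt_iff_tendsto_slope]
      have h1 := (hasDerivAt_iff_tendsto_slope.1 (hg r θ hr))
      have h2 : Tendsto (fun s => b s θ) (𝓝[≠] r) (𝓝 (b r θ)) := by
        have : ContinuousAt (fun q : ℝ × ℝ => b q.1 q.2) (r, θ) :=
          hbc.continuousAt ((isOpen_lt (by fun_prop) continuous_const).mem_nhds hr)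
        exact (ContinuousAt.comp (f := fun s : ℝ => (s, θ)) this
          (by fun_prop)).tendsto.mono_left nhdsWithin_le_nhds
      have h3 : Tendsto (fun s => B (slope (fun t => g t θ) r s) (b s θ)) (𝓝[≠] r)
          (𝓝 (B (g' r θ) (b r θ))) :=
        (isBoundedBilinearMap_apply.continuous.tendsto (B (g' r θ), b r θ)).comp
        (((B.continuous.tendsto _).comp h1).prodMk_nhds h2)
      refine h3.congr fun s => ?_
      simp [slope_def_module])
  have h4 := key.2.hasDerivAt
  rw [ContinuousLinearMap.integral_apply key.1] at h4
  simpa using h4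

/-- The velocity of the circle of radius `s` at angle `θ`. -/
theorem circleMap_mul_I_eq (s θ : ℝ) :
    circleMap 0 s θ * I = s • (I * circleMap 0 1 θ) := by
  simp [circleMap]; ring

theorem norm_circleMap_one (θ : ℝ) : ‖circleMap 0 1 θ‖ = 1 := by simp

variable {V : Type*} [NormedAddCommGroup V] [NormedSpace ℝ V]

/-- The integral of the one-form `α` along the image under `f` of the circle of radius `s`. -/
def formIntegral (α : V → V →L[ℝ] ℝ) (f : ℂ → V) (s : ℝ) : ℝ :=
  ∫ θ in (0 : ℝ)..2 * Real.pi,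
    α (f (circleMap 0 s θ)) (fderiv ℝ f (circleMap 0 s θ) (s • (I * circleMap 0 1 θ)))

/-- The density of the pull-back by `f` of the exterior derivative of `α`, integrated over the
circle of radius `s`. -/
def extDerivIntegral (α : V → V →L[ℝ] ℝ) (f : ℂ → V) (s : ℝ) : ℝ :=
  ∫ θ in (0 : ℝ)..2 * Real.pi,
    (fderiv ℝ α (f (circleMap 0 s θ)) (fderiv ℝ f (circleMap 0 s θ) (circleMap 0 1 θ))
        (fderiv ℝ f (circleMap 0 s θ) (I * circleMap 0 1 θ)) -
      fderiv ℝ α (f (circleMap 0 s θ)) (fderiv ℝ f (circleMap 0 s θ) (I * circleMap 0 1 θ))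
        (fderiv ℝ f (circleMap 0 s θ) (circleMap 0 1 θ)))

theorem circleMap_mem_ball {s d : ℝ} (hs : |s| < d) (θ : ℝ) : circleMap 0 s θ ∈ ball (0 : ℂ) d := by
  simpa using hs

theorem continuous_circleMap_uncurry : Continuous fun q : ℝ × ℝ => circleMap 0 q.1 q.2 := by
  unfold circleMap; fun_prop

theorem hasDerivAt_circleMap_radius (s θ : ℝ) :
    HasDerivAt (fun t : ℝ => circleMap 0 t θ) (circleMap 0 1 θ) s := by
  have h := (hasDerivAt_id s).ofReal_comp.mul_const (exp (θ * I))
  simpa [circleMap] using h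

theorem hasDerivAt_circleMap_angle (s θ : ℝ) :
    HasDerivAt (fun t : ℝ => circleMap 0 s t) (s • (I * circleMap 0 1 θ)) θ := by
  rw [← circleMap_mul_I_eq]; exact hasDerivAt_circleMap 0 s θ

variable {W : Type*} [NormedAddCommGroup W]

theorem continuousOn_comp_circleMap {k : ℂ → W} {d : ℝ} (hk : ContinuousOn k (ball 0 d)) :
    ContinuousOn (fun q : ℝ × ℝ => k (circleMap 0 q.1 q.2)) {q | |q.1| < d} :=
  hk.comp continuous_circleMap_uncurry.continuousOn fun q hq => circleMap_mem_ball hq q.2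

theorem continuous_comp_circleMap {k : ℂ → W} {d s : ℝ} (hk : ContinuousOn k (ball 0 d))
    (hs : |s| < d) : Continuous fun θ : ℝ => k (circleMap 0 s θ) :=
  hk.comp_continuous (continuous_circleMap 0 s) fun θ => circleMap_mem_ball hs θ

variable [NormedSpace ℝ W]

theorem hasDerivAt_comp_radius {k : ℂ → W} {d s : ℝ} (hk : DifferentiableOn ℝ k (ball 0 d))
    (hs : |s| < d) (θ : ℝ) :
    HasDerivAt (fun t : ℝ => k (circleMap 0 t θ))
      (fderiv ℝ k (circleMap 0 s θ) (circleMap 0 1 θ)) s :=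
  ((hk.differentiableAt (isOpen_ball.mem_nhds (circleMap_mem_ball hs θ))).hasFDerivAt).comp_hasDerivAt
    s (hasDerivAt_circleMap_radius s θ)

theorem hasDerivAt_comp_angle {k : ℂ → W} {d s : ℝ} (hk : DifferentiableOn ℝ k (ball 0 d))
    (hs : |s| < d) (θ : ℝ) :
    HasDerivAt (fun t : ℝ => k (circleMap 0 s t))
      (fderiv ℝ k (circleMap 0 s θ) (s • (I * circleMap 0 1 θ))) θ :=
  ((hk.differentiableAt (isOpen_ball.mem_nhds (circleMap_mem_ball hs θ))).hasFDerivAt).comp_hasDerivAt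
    θ (hasDerivAt_circleMap_angle s θ)

/-- The derivative with respect to the radius of a circle integral. -/
theorem hasDerivAt_circle_integral {k : ℂ → ℝ} {d r : ℝ} (hk : ContDiffOn ℝ 1 k (ball 0 d))
    (hr : |r| < d) :
    HasDerivAt (fun s => ∫ θ in (0 : ℝ)..2 * Real.pi, k (circleMap 0 s θ))
      (∫ θ in (0 : ℝ)..2 * Real.pi, fderiv ℝ k (circleMap 0 r θ) (circleMap 0 1 θ)) r := by
  have hkd := hk.differentiableOn one_ne_zero
  have hkf := hk.continuousOn_fderiv_of_isOpen isOpen_ball le_rfl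
  have h := hasDerivAt_integral_bilin (ContinuousLinearMap.mul ℝ ℝ)
    (g := fun s θ => k (circleMap 0 s θ))
    (g' := fun s θ => fderiv ℝ k (circleMap 0 s θ) (circleMap 0 1 θ))
    (b := fun _ _ => 1) hr (fun s θ hs => hasDerivAt_comp_radius hkd hs θ)
    (continuousOn_comp_circleMap hk.continuousOn)
    ((continuousOn_comp_circleMap hkf).clm_apply
      (by unfold circleMap; fun_prop)) continuousOn_const
  simp only [ContinuousLinearMap.mul_apply', mul_one] at h
  have h2 := h.add_const (∫ θ in (0 : ℝ)..2 * Real.pi, k (circleMap 0 r θ))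
  refine h2.congr_of_eventuallyEq ?_
  filter_upwards [(isOpen_lt continuous_abs continuous_const).mem_nhds hr] with s hs
  rw [← intervalIntegral.integral_add]
  · simp
  · exact ((continuous_comp_circleMap hk.continuousOn hs).sub
      (continuous_comp_circleMap hk.continuousOn hr)).intervalIntegrable _ _
  · exact (continuous_comp_circleMap hk.continuousOn hr).intervalIntegrable _ _

/-- **Stokes' theorem** on discs, in differentiated form, for the pull-back of a one-form of class
`C¹` by a map which is only of class `C¹`. -/
theorem hasDerivAt_formIntegral {f : ℂ → V} {d r : ℝ} {U : Set V} {α : V → V →L[ℝ] ℝ}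
    (hf : ContDiffOn ℝ 1 f (ball 0 d)) (hU : IsOpen U) (hfU : MapsTo f (ball 0 d) U)
    (hα : ContDiffOn ℝ 1 α U) (hr : |r| < d) :
    HasDerivAt (formIntegral α f) (r * extDerivIntegral α f r) r := by
  have hfd := hf.differentiableOn one_ne_zero
  have hff := hf.continuousOn_fderiv_of_isOpen isOpen_ball le_rfl
  set a : ℂ → V →L[ℝ] ℝ := fun z => α (f z) with ha_def
  have ha : ContDiffOn ℝ 1 a (ball 0 d) := hα.comp hf hfU
  have had := ha.differentiableOn one_ne_zero
  have haf := ha.continuousOn_fderiv_of_isOpen isOpen_ball le_rfl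
  have hchain : ∀ z ∈ ball (0 : ℂ) d, ∀ w, fderiv ℝ a z w = fderiv ℝ α (f z) (fderiv ℝ f z w) := by
    intro z hz w
    have h1 : DifferentiableAt ℝ α (f z) :=
      (hα.differentiableOn one_ne_zero).differentiableAt (hU.mem_nhds (hfU hz))
    have h2 : DifferentiableAt ℝ f z := hfd.differentiableAt (isOpen_ball.mem_nhds hz)
    have := fderiv_comp z h1 h2
    change fderiv ℝ (α ∘ f) z w = _
    rw [this]; rfl
  have hc1 : Continuous fun q : ℝ × ℝ => circleMap 0 1 q.2 := by unfold circleMap; fun_prop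
  have hc2 : Continuous fun q : ℝ × ℝ => q.1 • (I * circleMap 0 1 q.2) := by fun_prop
  have hQ := (continuousOn_comp_circleMap hff).clm_apply hc2.continuousOn
  have hP := (continuousOn_comp_circleMap hff).clm_apply hc1.continuousOn
  have h1 := hasDerivAt_integral_bilin (ContinuousLinearMap.id ℝ (V →L[ℝ] ℝ))
    (g := fun s θ => a (circleMap 0 s θ))
    (g' := fun s θ => fderiv ℝ a (circleMap 0 s θ) (circleMap 0 1 θ))
    (b := fun s θ => fderiv ℝ f (circleMap 0 s θ) (s • (I * circleMap 0 1 θ))) hr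
    (fun s θ hs => hasDerivAt_comp_radius had hs θ)
    (continuousOn_comp_circleMap ha.continuousOn)
    ((continuousOn_comp_circleMap haf).clm_apply hc1.continuousOn) hQ
  have hcr : Continuous fun θ : ℝ => fderiv ℝ a (circleMap 0 r θ) (r • (I * circleMap 0 1 θ)) :=
    (continuous_comp_circleMap haf hr).clm_apply (by fun_prop)
  have h2 := hasDerivAt_integral_bilin (ContinuousLinearMap.id ℝ (V →L[ℝ] ℝ)).flip
    (g := fun s θ => f (circleMap 0 s θ))
    (g' := fun s θ => fderiv ℝ f (circleMap 0 s θ) (circleMap 0 1 θ))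
    (b := fun _ θ => fderiv ℝ a (circleMap 0 r θ) (r • (I * circleMap 0 1 θ))) hr
    (fun s θ hs => hasDerivAt_comp_radius hfd hs θ)
    (continuousOn_comp_circleMap hf.continuousOn) hP
    (hcr.comp continuous_snd).continuousOn
  simp only [ContinuousLinearMap.id_apply, ContinuousLinearMap.flip_apply] at h1 h2
  have hslice1 : ∀ s, |s| < d → Continuous fun θ : ℝ =>
      fderiv ℝ f (circleMap 0 s θ) (s • (I * circleMap 0 1 θ)) := fun s hs =>
    (continuous_comp_circleMap hff hs).clm_apply (by fun_prop)
  have hslice0 : ∀ s, |s| < d → Continuous fun θ : ℝ => f (circleMap 0 s θ) := fun s hs =>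
    continuous_comp_circleMap hf.continuousOn hs
  have hslicea : ∀ s, |s| < d → Continuous fun θ : ℝ => a (circleMap 0 s θ) := fun s hs =>
    continuous_comp_circleMap ha.continuousOn hs
  have h3 := (h1.sub h2).add_const (formIntegral α f r)
  refine (h3.congr_of_eventuallyEq ?_).congr_deriv ?_
  · filter_upwards [(isOpen_lt continuous_abs continuous_const).mem_nhds hr] with s hs
    have hs' : |s| < d := hs
    -- Integration by parts in `θ`. It moves the angular derivative off `f_s - f_r`, whose radial
    -- derivative can then be taken although `f` has no second derivatives.
    have hparts : ∫ θ in (0 : ℝ)..2 * Real.pi,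
        (fderiv ℝ a (circleMap 0 r θ) (r • (I * circleMap 0 1 θ))
            (f (circleMap 0 s θ) - f (circleMap 0 r θ)) +
          a (circleMap 0 r θ) (fderiv ℝ f (circleMap 0 s θ) (s • (I * circleMap 0 1 θ)) -
            fderiv ℝ f (circleMap 0 r θ) (r • (I * circleMap 0 1 θ)))) = 0 := by
      rw [intervalIntegral.integral_eq_sub_of_hasDerivAt
        (f := fun θ => a (circleMap 0 r θ) (f (circleMap 0 s θ) - f (circleMap 0 r θ)))]
      · simp [circleMap]
      · intro θ _
        exact (hasDerivAt_comp_angle had hr θ).clm_apply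
          ((hasDerivAt_comp_angle hfd hs' θ).sub (hasDerivAt_comp_angle hfd hr θ))
      · exact ((hcr.clm_apply ((hslice0 s hs').sub (hslice0 r hr))).add
          ((hslicea r hr).clm_apply ((hslice1 s hs').sub (hslice1 r hr)))).intervalIntegrable _ _
    have hi1 : IntervalIntegrable (fun θ : ℝ => (a (circleMap 0 s θ) - a (circleMap 0 r θ))
        (fderiv ℝ f (circleMap 0 s θ) (s • (I * circleMap 0 1 θ)))) volume 0 (2 * Real.pi) :=
      (((hslicea s hs').sub (hslicea r hr)).clm_apply (hslice1 s hs')).intervalIntegrable _ _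
    have hi2 : IntervalIntegrable (fun θ : ℝ =>
        fderiv ℝ a (circleMap 0 r θ) (r • (I * circleMap 0 1 θ))
            (f (circleMap 0 s θ) - f (circleMap 0 r θ))) volume 0 (2 * Real.pi) :=
      (hcr.clm_apply ((hslice0 s hs').sub (hslice0 r hr))).intervalIntegrable _ _
    have hi3 : IntervalIntegrable (fun θ : ℝ =>
          a (circleMap 0 r θ) (fderiv ℝ f (circleMap 0 s θ) (s • (I * circleMap 0 1 θ)) -
            fderiv ℝ f (circleMap 0 r θ) (r • (I * circleMap 0 1 θ)))) volume 0 (2 * Real.pi) :=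
      ((hslicea r hr).clm_apply ((hslice1 s hs').sub (hslice1 r hr))).intervalIntegrable _ _
    have hi4 : IntervalIntegrable (fun θ : ℝ => a (circleMap 0 r θ)
          (fderiv ℝ f (circleMap 0 r θ) (r • (I * circleMap 0 1 θ)))) volume 0 (2 * Real.pi) :=
      ((hslicea r hr).clm_apply (hslice1 r hr)).intervalIntegrable _ _
    rw [intervalIntegral.integral_add hi2 hi3] at hparts
    have hsum : formIntegral α f s =
        (∫ θ in (0 : ℝ)..2 * Real.pi, (a (circleMap 0 s θ) - a (circleMap 0 r θ))
          (fderiv ℝ f (circleMap 0 s θ) (s • (I * circleMap 0 1 θ)))) +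
        (∫ θ in (0 : ℝ)..2 * Real.pi,
          a (circleMap 0 r θ) (fderiv ℝ f (circleMap 0 s θ) (s • (I * circleMap 0 1 θ)) -
            fderiv ℝ f (circleMap 0 r θ) (r • (I * circleMap 0 1 θ)))) + formIntegral α f r := by
      unfold formIntegral
      rw [← intervalIntegral.integral_add hi1 hi3, ← intervalIntegral.integral_add (hi1.add hi3) hi4]
      refine intervalIntegral.integral_congr fun θ _ => ?_
      simp only [map_sub, sub_apply, ha_def]
      ring
    simp only [Pi.sub_apply]
    rw [hsum]
    linarith
  · rw [extDerivIntegral, ← intervalIntegral.integral_const_mul,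
      ← intervalIntegral.integral_sub]
    · refine intervalIntegral.integral_congr fun θ _ => ?_
      simp only [hchain _ (circleMap_mem_ball hr θ), map_smul, smul_eq_mul,
        smul_apply]
      ring
    · exact (((continuous_comp_circleMap haf hr).clm_apply (by fun_prop)).clm_apply
        (hslice1 r hr)).intervalIntegrable _ _
    · exact (hcr.clm_apply ((continuous_comp_circleMap hff hr).clm_apply
        (by fun_prop))).intervalIntegrable _ _

end CircleCalculus

/-! ### Wirtinger's inequality and the isoperimetric inequality. -/

section Wirtinger

/-- **Wirtinger's inequality** for real functions of period `2π`. -/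
theorem exists_integral_sub_sq_le {g g' : ℝ → ℝ} (hg : ∀ θ, HasDerivAt g (g' θ) θ)
    (hg' : Continuous g') (hper : g (2 * Real.pi) = g 0) :
    ∃ c : ℝ, ∫ θ in (0 : ℝ)..2 * Real.pi, (g θ - c) ^ 2 ≤
      ∫ θ in (0 : ℝ)..2 * Real.pi, g' θ ^ 2 := by
  have hpi : (0 : ℝ) < 2 * Real.pi := by positivity
  have hgc : Continuous g := continuous_iff_continuousAt.2 fun θ => (hg θ).continuousAt
  -- Subtracting the mean kills the Fourier coefficient at frequency 0. At every other frequency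
  -- `m`, differentiation multiplies the modulus by `|m| ≥ 1`, and Parseval concludes.
  set c : ℝ := (2 * Real.pi)⁻¹ * ∫ θ in (0 : ℝ)..2 * Real.pi, g θ with hc
  refine ⟨c, ?_⟩
  set F : ℝ → ℂ := fun θ => ((g θ - c : ℝ) : ℂ) with hF
  set F' : ℝ → ℂ := fun θ => (g' θ : ℂ) with hF'
  have hFd : ∀ θ, HasDerivAt F (F' θ) θ := fun θ => ((hg θ).sub_const c).ofReal_comp
  have hFc : Continuous F := by fun_prop
  have hF'c : Continuous F' := by fun_prop
  have hLp : ∀ k : ℝ → ℂ, Continuous k → MemLp k 2 (volume.restrict (Ioc 0 (2 * Real.pi))) := by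
    intro k hk
    obtain ⟨M, hM⟩ := (isCompact_Icc (a := (0 : ℝ)) (b := 2 * Real.pi)).exists_bound_of_continuousOn
      hk.continuousOn
    refine MemLp.of_bound hk.aestronglyMeasurable M ?_
    refine (ae_restrict_iff' measurableSet_Ioc).2 (Eventually.of_forall fun x hx => ?_)
    exact hM x ⟨hx.1.le, hx.2⟩
  have h1 := hasSum_sq_fourierCoeffOn hpi (hLp F hFc)
  have h2 := hasSum_sq_fourierCoeffOn hpi (hLp F' hF'c)
  have hle : ∀ n : ℤ, ‖fourierCoeffOn hpi F n‖ ^ 2 ≤ ‖fourierCoeffOn hpi F' n‖ ^ 2 := by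
    intro n
    rcases eq_or_ne n 0 with rfl | hn
    · have : fourierCoeffOn hpi F 0 = 0 := by
        rw [fourierCoeffOn_eq_integral]
        have : ∫ θ in (0 : ℝ)..2 * Real.pi, (g θ - c) = 0 := by
          rw [intervalIntegral.integral_sub (hgc.intervalIntegrable _ _)
            (continuous_const.intervalIntegrable _ _), intervalIntegral.integral_const, hc]
          simp only [sub_zero, smul_eq_mul]
          field_simp
          ring
        simp only [neg_zero, fourier_zero, one_smul, hF, intervalIntegral.integral_ofReal, this]
        simp
      rw [this]
      simp
    · have h3 := fourierCoeffOn_of_hasDerivAt hpi hn (fun x _ => hFd x)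
        (hF'c.intervalIntegrable _ _)
      have h4 : F (2 * Real.pi) - F 0 = 0 := by simp [hF, hper]
      rw [h4, mul_zero, zero_sub] at h3
      have h5 : ‖fourierCoeffOn hpi F n‖ = ‖fourierCoeffOn hpi F' n‖ / |(n : ℝ)| := by
        rw [h3]
        simp only [norm_mul, norm_div, norm_neg, norm_one, sub_zero, Complex.norm_I,
          Complex.norm_real, Complex.norm_intCast, Real.norm_eq_abs, Complex.norm_ofNat,
          Complex.ofReal_mul, Complex.ofReal_ofNat, Complex.ofReal_zero]
        rw [abs_of_pos Real.pi_pos]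
        have : |(n : ℝ)| ≠ 0 := by simpa using hn
        field_simp
      have h6 : (1 : ℝ) ≤ |(n : ℝ)| := by
        exact_mod_cast Int.one_le_abs hn
      rw [h5]
      gcongr
      exact div_le_self (norm_nonneg _) h6
  have h7 := hasSum_le hle h1 h2
  simp only [hF, hF', Complex.norm_real, Real.norm_eq_abs, sq_abs, sub_zero, smul_eq_mul] at h7
  exact le_of_mul_le_mul_left h7 (by positivity)

variable {ι : Type*} [Fintype ι]

/-- Wirtinger's inequality for closed curves in Euclidean space. -/
theorem exists_integral_norm_sub_sq_le {g g' : ℝ → EuclideanSpace ℝ ι}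
    (hg : ∀ θ, HasDerivAt g (g' θ) θ) (hg' : Continuous g') (hper : g (2 * Real.pi) = g 0) :
    ∃ c : EuclideanSpace ℝ ι, ∫ θ in (0 : ℝ)..2 * Real.pi, ‖g θ - c‖ ^ 2 ≤
      ∫ θ in (0 : ℝ)..2 * Real.pi, ‖g' θ‖ ^ 2 := by
  have hgc : Continuous g := continuous_iff_continuousAt.2 fun θ => (hg θ).continuousAt
  have hcomp : ∀ i, ∃ c : ℝ, ∫ θ in (0 : ℝ)..2 * Real.pi, (g θ i - c) ^ 2 ≤
      ∫ θ in (0 : ℝ)..2 * Real.pi, (g' θ i) ^ 2 := fun i =>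
    exists_integral_sub_sq_le
      (fun θ => (EuclideanSpace.proj (𝕜 := ℝ) i).hasFDerivAt.comp_hasDerivAt θ (hg θ))
      (by fun_prop) (by simp [hper])
  choose c hc using hcomp
  refine ⟨WithLp.toLp 2 c, ?_⟩
  simp only [EuclideanSpace.real_norm_sq_eq, PiLp.sub_apply]
  rw [intervalIntegral.integral_finsetSum, intervalIntegral.integral_finsetSum]
  · exact Finset.sum_le_sum fun i _ => hc i
  · intro i _
    exact Continuous.intervalIntegrable (by fun_prop) _ _
  · intro i _
    exact Continuous.intervalIntegrable (by fun_prop) _ _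

/-- The **isoperimetric inequality** for the symplectic area of a closed curve. -/
theorem integral_inner_le_integral_norm_sq {g g' : ℝ → EuclideanSpace ℝ ι}
    (J₀ : EuclideanSpace ℝ ι →L[ℝ] EuclideanSpace ℝ ι) (hJ₀ : ∀ x, ‖J₀ x‖ = ‖x‖)
    (hg : ∀ θ, HasDerivAt g (g' θ) θ) (hg' : Continuous g') (hper : g (2 * Real.pi) = g 0) :
    ∫ θ in (0 : ℝ)..2 * Real.pi, inner ℝ (J₀ (g θ)) (g' θ) ≤
      ∫ θ in (0 : ℝ)..2 * Real.pi, ‖g' θ‖ ^ 2 := by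
  have hpi : (0 : ℝ) ≤ 2 * Real.pi := by positivity
  have hgc : Continuous g := continuous_iff_continuousAt.2 fun θ => (hg θ).continuousAt
  obtain ⟨c, hc⟩ := exists_integral_norm_sub_sq_le hg hg' hper
  -- The symplectic area of a closed curve is invariant under translation, so the curve may be
  -- centred at Wirtinger's `c`.
  have hconst : ∫ θ in (0 : ℝ)..2 * Real.pi, inner ℝ (J₀ c) (g' θ) = 0 := by
    rw [intervalIntegral.integral_eq_sub_of_hasDerivAt (f := fun θ => inner ℝ (J₀ c) (g θ))]
    · simp [hper]
    · intro θ _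
      exact (innerSL ℝ (J₀ c)).hasFDerivAt.comp_hasDerivAt θ (hg θ)
    · exact Continuous.intervalIntegrable (by fun_prop) _ _
  have hi : ∀ k : ℝ → ℝ, Continuous k → IntervalIntegrable k volume 0 (2 * Real.pi) :=
    fun k hk => hk.intervalIntegrable _ _
  have h1 : ∫ θ in (0 : ℝ)..2 * Real.pi, inner ℝ (J₀ (g θ)) (g' θ) =
      ∫ θ in (0 : ℝ)..2 * Real.pi, inner ℝ (J₀ (g θ - c)) (g' θ) := by
    simp only [map_sub, inner_sub_left]
    rw [intervalIntegral.integral_sub (hi _ (by fun_prop)) (hi _ (by fun_prop)), hconst, sub_zero]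
  rw [h1]
  have h2 : ∫ θ in (0 : ℝ)..2 * Real.pi, inner ℝ (J₀ (g θ - c)) (g' θ) ≤
      ∫ θ in (0 : ℝ)..2 * Real.pi, ((1 / 2) * ‖g θ - c‖ ^ 2 + (1 / 2) * ‖g' θ‖ ^ 2) := by
    refine intervalIntegral.integral_mono_on hpi (hi _ (by fun_prop)) (hi _ (by fun_prop)) ?_
    intro θ _
    have h3 := real_inner_le_norm (J₀ (g θ - c)) (g' θ)
    rw [hJ₀] at h3
    nlinarith [sq_nonneg (‖g θ - c‖ - ‖g' θ‖)]
  rw [intervalIntegral.integral_add (hi _ (by fun_prop)) (hi _ (by fun_prop)),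
    intervalIntegral.integral_const_mul, intervalIntegral.integral_const_mul] at h2
  linarith

end Wirtinger

/-! ### Growth of the symplectic area of almost holomorphic discs. -/

section Area

variable {ι : Type*} [Fintype ι]

/-- The primitive `x ↦ ½ ⟨J₀ x, ·⟩` of the symplectic form `⟨J₀ ·, ·⟩`. -/
def areaForm (J₀ : EuclideanSpace ℝ ι →L[ℝ] EuclideanSpace ℝ ι) :
    EuclideanSpace ℝ ι →L[ℝ] EuclideanSpace ℝ ι →L[ℝ] ℝ :=
  (1 / 2 : ℝ) • ((innerSL ℝ : EuclideanSpace ℝ ι →L[ℝ] EuclideanSpace ℝ ι →L[ℝ] ℝ).comp J₀)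

theorem areaForm_apply (J₀ : EuclideanSpace ℝ ι →L[ℝ] EuclideanSpace ℝ ι)
    (x y : EuclideanSpace ℝ ι) : areaForm J₀ x y = 1 / 2 * inner ℝ (J₀ x) y := by
  simp [areaForm]

/-- A complex structure on Euclidean space compatible with the inner product. -/
structure IsOrthogonalComplexStructure
    (J₀ : EuclideanSpace ℝ ι →L[ℝ] EuclideanSpace ℝ ι) : Prop where
  norm_map : ∀ x, ‖J₀ x‖ = ‖x‖
  sq_eq : ∀ x, J₀ (J₀ x) = -x

variable {J₀ : EuclideanSpace ℝ ι →L[ℝ] EuclideanSpace ℝ ι}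

theorem IsOrthogonalComplexStructure.inner_map_left (hJ : IsOrthogonalComplexStructure J₀)
    (x y : EuclideanSpace ℝ ι) : inner ℝ (J₀ x) y = -inner ℝ (J₀ y) x := by
  have h := hJ.norm_map (x + J₀ y)
  have h1 := norm_add_sq_real (J₀ x) (J₀ (J₀ y))
  have h2 := norm_add_sq_real x (J₀ y)
  rw [← map_add, h, h2, hJ.sq_eq, inner_neg_right, norm_neg, hJ.norm_map x, hJ.norm_map y] at h1
  have h3 := real_inner_comm x (J₀ y)
  linarith

theorem IsOrthogonalComplexStructure.inner_self (hJ : IsOrthogonalComplexStructure J₀)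
    (x : EuclideanSpace ℝ ι) : inner ℝ (J₀ x) x = 0 := by
  have := hJ.inner_map_left x x
  linarith

theorem IsOrthogonalComplexStructure.abs_inner_sub_le (hJ : IsOrthogonalComplexStructure J₀)
    {η : ℝ} {X Y : EuclideanSpace ℝ ι} (hXY : ‖Y - J₀ X‖ ≤ η * ‖X‖) :
    |inner ℝ (J₀ X) Y - ‖X‖ ^ 2| ≤ η * ‖X‖ ^ 2 := by
  have h1 : inner ℝ (J₀ X) Y - ‖X‖ ^ 2 = inner ℝ (J₀ X) (Y - J₀ X) := by
    rw [inner_sub_right, real_inner_self_eq_norm_sq, hJ.norm_map]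
  rw [h1]
  calc |inner ℝ (J₀ X) (Y - J₀ X)| ≤ ‖J₀ X‖ * ‖Y - J₀ X‖ := abs_real_inner_le_norm _ _
    _ ≤ ‖X‖ * (η * ‖X‖) := by rw [hJ.norm_map]; gcongr
    _ = η * ‖X‖ ^ 2 := by ring

/-- The constant 7 makes `(1 + η)² ≤ (1 + 7η)(1 - η)` equivalent to `8η² ≤ 4η`, which covers the
range `0 ≤ η ≤ 1/2`. -/
theorem IsOrthogonalComplexStructure.norm_sq_le (hJ : IsOrthogonalComplexStructure J₀)
    {η : ℝ} (hη0 : 0 ≤ η) (hη : η ≤ 1 / 2) {X Y : EuclideanSpace ℝ ι}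
    (hXY : ‖Y - J₀ X‖ ≤ η * ‖X‖) : ‖Y‖ ^ 2 ≤ (1 + 7 * η) * inner ℝ (J₀ X) Y := by
  have h1 := (abs_le.1 (hJ.abs_inner_sub_le hXY)).1
  have h2 : ‖Y‖ ≤ (1 + η) * ‖X‖ := by
    have := norm_le_norm_add_norm_sub' Y (J₀ X)
    rw [hJ.norm_map] at this
    linarith
  have h3 : ‖Y‖ ^ 2 ≤ (1 + η) ^ 2 * ‖X‖ ^ 2 := by
    rw [← mul_pow]; gcongr
  have h4 : (1 + 7 * η) * ((1 - η) * ‖X‖ ^ 2) ≤ (1 + 7 * η) * inner ℝ (J₀ X) Y := by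
    gcongr; linarith
  have h5 : (1 + η) ^ 2 * ‖X‖ ^ 2 ≤ (1 + 7 * η) * (1 - η) * ‖X‖ ^ 2 := by
    gcongr; nlinarith
  linarith

variable {f : ℂ → EuclideanSpace ℝ ι} {d : ℝ} {η : ℝ → ℝ}

/-- The symplectic energy density of `f`, integrated over the circle of radius `r`. -/
def areaDensity (J₀ : EuclideanSpace ℝ ι →L[ℝ] EuclideanSpace ℝ ι) (f : ℂ → EuclideanSpace ℝ ι)
    (r : ℝ) : ℝ :=
  ∫ θ in (0 : ℝ)..2 * Real.pi, inner ℝ (J₀ (fderiv ℝ f (circleMap 0 r θ) (circleMap 0 1 θ)))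
    (fderiv ℝ f (circleMap 0 r θ) (I * circleMap 0 1 θ))

/-- `f` satisfies the Cauchy–Riemann equations for `J₀` on the disc of radius `d`, up to a relative
error `η (‖z‖)`. -/
def IsAlmostHolOn (J₀ : EuclideanSpace ℝ ι →L[ℝ] EuclideanSpace ℝ ι)
    (f : ℂ → EuclideanSpace ℝ ι) (d : ℝ) (η : ℝ → ℝ) : Prop :=
  ∀ z ∈ ball (0 : ℂ) d, ∀ w : ℂ,
    ‖fderiv ℝ f z (I * w) - J₀ (fderiv ℝ f z w)‖ ≤ η ‖z‖ * ‖fderiv ℝ f z w‖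

theorem hasDerivAt_area (hJ : IsOrthogonalComplexStructure J₀) (hf : ContDiffOn ℝ 1 f (ball 0 d))
    {r : ℝ} (hr : |r| < d) :
    HasDerivAt (formIntegral (areaForm J₀) f) (r * areaDensity J₀ f r) r := by
  have h := hasDerivAt_formIntegral hf isOpen_univ (mapsTo_univ _ _)
    (areaForm J₀).contDiff.contDiffOn hr
  refine h.congr_deriv ?_
  congr 1
  refine intervalIntegral.integral_congr fun θ _ => ?_
  simp only [ContinuousLinearMap.fderiv, areaForm_apply]
  rw [hJ.inner_map_left (fderiv ℝ f _ (I * _))]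
  ring

theorem formIntegral_zero {V : Type*} [NormedAddCommGroup V] [NormedSpace ℝ V]
    (α : V → V →L[ℝ] ℝ) (f : ℂ → V) : formIntegral α f 0 = 0 := by
  simp [formIntegral]

theorem continuous_fderiv_circle (hf : ContDiffOn ℝ 1 f (ball 0 d)) {r : ℝ} (hr : |r| < d)
    {w : ℝ → ℂ} (hw : Continuous w) :
    Continuous fun θ : ℝ => fderiv ℝ f (circleMap 0 r θ) (w θ) :=
  (continuous_comp_circleMap (hf.continuousOn_fderiv_of_isOpen isOpen_ball le_rfl) hr).clm_apply hw

theorem areaDensity_nonneg (hJ : IsOrthogonalComplexStructure J₀)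
    (hη : IsAlmostHolOn J₀ f d η) {r : ℝ} (hr0 : 0 ≤ r) (hr : r < d) (hηr : η r ≤ 1) :
    0 ≤ areaDensity J₀ f r := by
  refine intervalIntegral.integral_nonneg (by positivity) fun θ _ => ?_
  have hz : circleMap 0 r θ ∈ ball (0 : ℂ) d :=
    circleMap_mem_ball (by rwa [abs_of_nonneg hr0]) θ
  have h := hη _ hz (circleMap 0 1 θ)
  rw [norm_circleMap_zero, abs_of_nonneg hr0] at h
  have h1 := (abs_le.1 (hJ.abs_inner_sub_le h)).1
  nlinarith [sq_nonneg ‖fderiv ℝ f (circleMap 0 r θ) (circleMap 0 1 θ)‖]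

theorem integral_norm_sq_le_areaDensity (hJ : IsOrthogonalComplexStructure J₀)
    (hf : ContDiffOn ℝ 1 f (ball 0 d)) (hη : IsAlmostHolOn J₀ f d η) {r : ℝ} (hr0 : 0 ≤ r)
    (hr : r < d) (hηr0 : 0 ≤ η r) (hηr : η r ≤ 1 / 2) :
    ∫ θ in (0 : ℝ)..2 * Real.pi,
        ‖fderiv ℝ f (circleMap 0 r θ) (r • (I * circleMap 0 1 θ))‖ ^ 2 ≤
      (1 + 7 * η r) * (r ^ 2 * areaDensity J₀ f r) := by
  have hr' : |r| < d := by rwa [abs_of_nonneg hr0]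
  have hX := continuous_fderiv_circle hf hr' (w := fun θ => circleMap 0 1 θ) (by fun_prop)
  have hY := continuous_fderiv_circle hf hr' (w := fun θ => I * circleMap 0 1 θ) (by fun_prop)
  have hrY := continuous_fderiv_circle hf hr' (w := fun θ => r • (I * circleMap 0 1 θ))
    (by fun_prop)
  rw [areaDensity, ← mul_assoc, ← intervalIntegral.integral_const_mul]
  refine intervalIntegral.integral_mono_on (by positivity)
    (Continuous.intervalIntegrable (by fun_prop) _ _)
    (Continuous.intervalIntegrable (by fun_prop) _ _) fun θ _ => ?_
  have h := hη _ (circleMap_mem_ball hr' θ) (circleMap 0 1 θ)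
  rw [norm_circleMap_zero, abs_of_nonneg hr0] at h
  have h1 := hJ.norm_sq_le hηr0 hηr h
  rw [map_smul, norm_smul, mul_pow, Real.norm_eq_abs, sq_abs]
  nlinarith [mul_le_mul_of_nonneg_left h1 (sq_nonneg r)]

/-- This is the differential inequality `2A ≤ (1 + 7η) r A'`, since `A' = r * areaDensity`. The
sharp isoperimetric constant is what gives quadratic growth when `η` tends to 0. -/
theorem area_le (hJ : IsOrthogonalComplexStructure J₀) (hf : ContDiffOn ℝ 1 f (ball 0 d))
    (hη : IsAlmostHolOn J₀ f d η) {r : ℝ} (hr0 : 0 ≤ r) (hr : r < d) (hηr0 : 0 ≤ η r)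
    (hηr : η r ≤ 1 / 2) :
    2 * formIntegral (areaForm J₀) f r ≤ (1 + 7 * η r) * (r ^ 2 * areaDensity J₀ f r) := by
  have hr' : |r| < d := by rwa [abs_of_nonneg hr0]
  refine le_trans ?_ (integral_norm_sq_le_areaDensity hJ hf hη hr0 hr hηr0 hηr)
  have h := integral_inner_le_integral_norm_sq (g := fun θ => f (circleMap 0 r θ)) J₀ hJ.norm_map
    (fun θ => hasDerivAt_comp_angle (hf.differentiableOn one_ne_zero) hr' θ)
    (continuous_fderiv_circle hf hr' (by fun_prop)) (by simp [circleMap])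
  refine le_trans (le_of_eq ?_) h
  simp only [formIntegral, areaForm_apply, intervalIntegral.integral_const_mul]
  ring

theorem area_monotoneOn (hJ : IsOrthogonalComplexStructure J₀) (hf : ContDiffOn ℝ 1 f (ball 0 d))
    (hη : IsAlmostHolOn J₀ f d η) (hη1 : ∀ r, 0 ≤ r → r < d → η r ≤ 1) :
    MonotoneOn (formIntegral (areaForm J₀) f) (Ico 0 d) := by
  have hder : ∀ r ∈ Ico 0 d, HasDerivAt (formIntegral (areaForm J₀) f)
      (r * areaDensity J₀ f r) r := fun r hr =>
    hasDerivAt_area hJ hf (by rw [abs_of_nonneg hr.1]; exact hr.2)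
  refine monotoneOn_of_hasDerivWithinAt_nonneg (convex_Ico 0 d)
    (fun r hr => (hder r hr).continuousAt.continuousWithinAt)
    (fun r hr => (hder r (interior_subset hr)).hasDerivWithinAt) fun r hr => ?_
  have hr := interior_subset hr
  exact mul_nonneg hr.1 (areaDensity_nonneg hJ hη hr.1 hr.2 (hη1 r hr.1 hr.2))

/-- The area of almost holomorphic discs decays at least linearly. -/
theorem area_mul_le_mul_area (hJ : IsOrthogonalComplexStructure J₀)
    (hf : ContDiffOn ℝ 1 f (ball 0 d)) (hη : IsAlmostHolOn J₀ f d η)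
    (hη0 : ∀ r, 0 ≤ r → r < d → 0 ≤ η r) (hη1 : ∀ r, 0 ≤ r → r < d → η r ≤ 1 / 7)
    {r s : ℝ} (hr0 : 0 < r) (hrs : r ≤ s) (hs : s < d) :
    formIntegral (areaForm J₀) f r * s ≤ formIntegral (areaForm J₀) f s * r := by
  set A := formIntegral (areaForm J₀) f with hA
  have hder : ∀ r ∈ Ioo 0 d, HasDerivAt (fun r => A r / r)
      ((r * areaDensity J₀ f r * r - A r * 1) / r ^ 2) r := fun r hr =>
    (hasDerivAt_area hJ hf (by rw [abs_of_pos hr.1]; exact hr.2)).div (hasDerivAt_id r) hr.1.ne'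
  have hmono : MonotoneOn (fun r => A r / r) (Ioo 0 d) := by
    refine monotoneOn_of_hasDerivWithinAt_nonneg (convex_Ioo 0 d)
      (fun r hr => (hder r hr).continuousAt.continuousWithinAt)
      (fun r hr => (hder r (interior_subset hr)).hasDerivWithinAt) fun r hr => ?_
    have hr := interior_subset hr
    have h1 := area_le hJ hf hη hr.1.le hr.2 (hη0 r hr.1.le hr.2)
      ((hη1 r hr.1.le hr.2).trans (by norm_num))
    have h2 := areaDensity_nonneg hJ hη hr.1.le hr.2 ((hη1 r hr.1.le hr.2).trans (by norm_num))
    have h3 : 0 ≤ r ^ 2 * areaDensity J₀ f r := by positivity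
    have h4 := hη1 r hr.1.le hr.2
    -- The numerator is `r (r A' - A)`-like in sign: `1 + 7η ≤ 2` turns `area_le` into `A ≤ r A'`.
    refine div_nonneg ?_ (sq_nonneg r)
    nlinarith
  have h := hmono ⟨hr0, hrs.trans_lt hs⟩ ⟨hr0.trans_le hrs, hs⟩ hrs
  simp only at h
  rwa [div_le_div_iff₀ hr0 (hr0.trans_le hrs)] at h

/-- An absolute bound for the area of the inner half of an almost holomorphic disc in the unit
ball. -/
theorem area_le_two_pi (hJ : IsOrthogonalComplexStructure J₀)
    (hf : ContDiffOn ℝ 1 f (ball 0 d)) (hη : IsAlmostHolOn J₀ f d η)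
    (hη0 : ∀ r, 0 ≤ r → r < d → 0 ≤ η r) (hη1 : ∀ r, 0 ≤ r → r < d → η r ≤ 1 / 7)
    (hf1 : ∀ z ∈ ball (0 : ℂ) d, ‖f z‖ ≤ 1) {r : ℝ} (hr0 : 0 < r) (hr : 2 * r < d) :
    formIntegral (areaForm J₀) f r ≤ 2 * Real.pi := by
  set A := formIntegral (areaForm J₀) f with hA
  have hpi := Real.pi_pos
  rcases le_or_gt (A r) 0 with h0 | hpos
  · linarith
  have hη1' : ∀ r, 0 ≤ r → r < d → η r ≤ 1 := fun r h1 h2 => (hη1 r h1 h2).trans (by norm_num)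
  have hApos : ∀ s ∈ Icc r (2 * r), 0 < A s := fun s hs =>
    hpos.trans_le (area_monotoneOn hJ hf hη hη1' ⟨hr0.le, by linarith⟩
      ⟨hr0.le.trans hs.1, hs.2.trans_lt hr⟩ hs.1)
  have hkey : ∀ s ∈ Icc r (2 * r), A s ^ 2 ≤ Real.pi * (s * (s * areaDensity J₀ f s)) := by
    intro s hs
    have hs0 : 0 ≤ s := hr0.le.trans hs.1
    have hsd : s < d := hs.2.trans_lt hr
    have hs' : |s| < d := by rwa [abs_of_nonneg hs0]
    have hP := continuous_comp_circleMap hf.continuousOn hs'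
    have hY := continuous_fderiv_circle hf hs' (w := fun θ => s • (I * circleMap 0 1 θ))
      (by fun_prop)
    have hAs := hApos s hs
    have h1 := integral_norm_sq_le_areaDensity hJ hf hη hs0 hsd (hη0 s hs0 hsd)
      ((hη1 s hs0 hsd).trans (by norm_num))
    -- Since `‖f‖ ≤ 1`, the area is at most half the length. Cauchy–Schwarz is replaced by an AM-GM
    -- whose weight makes the first term integrate to `A s / 2`, to be absorbed on the left.
    have h2 : A s ≤ ∫ θ in (0 : ℝ)..2 * Real.pi, (A s / (4 * Real.pi) + Real.pi / (4 * A s) *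
        ‖fderiv ℝ f (circleMap 0 s θ) (s • (I * circleMap 0 1 θ))‖ ^ 2) := by
      conv_lhs => rw [hA, formIntegral]
      simp only [areaForm_apply]
      refine intervalIntegral.integral_mono_on (by positivity)
        ((continuous_const.mul ((J₀.continuous.comp hP).inner hY)).intervalIntegrable _ _)
        (Continuous.intervalIntegrable (by fun_prop) _ _) fun θ _ => ?_
      set y := fderiv ℝ f (circleMap 0 s θ) (s • (I * circleMap 0 1 θ)) with hy
      have h3 := real_inner_le_norm (J₀ (f (circleMap 0 s θ))) y
      rw [hJ.norm_map] at h3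
      have h4 := hf1 _ (circleMap_mem_ball hs' θ)
      have h5 : ‖f (circleMap 0 s θ)‖ * ‖y‖ ≤ ‖y‖ := mul_le_of_le_one_left (norm_nonneg _) h4
      have h6 : A s / (4 * Real.pi) + Real.pi / (4 * A s) * ‖y‖ ^ 2 - 1 / 2 * ‖y‖ =
          (A s - Real.pi * ‖y‖) ^ 2 / (4 * Real.pi * A s) := by
        field_simp
        ring
      have h7 : 0 ≤ (A s - Real.pi * ‖y‖) ^ 2 / (4 * Real.pi * A s) := by positivity
      linarith
    rw [intervalIntegral.integral_add (continuous_const.intervalIntegrable _ _)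
      (Continuous.intervalIntegrable (by fun_prop) _ _), intervalIntegral.integral_const,
      intervalIntegral.integral_const_mul, sub_zero, smul_eq_mul] at h2
    have h8 : 0 ≤ s ^ 2 * areaDensity J₀ f s :=
      mul_nonneg (sq_nonneg s) (areaDensity_nonneg hJ hη hs0 hsd (hη1' s hs0 hsd))
    have h9 : (1 + 7 * η s) * (s ^ 2 * areaDensity J₀ f s) ≤ 2 * (s ^ 2 * areaDensity J₀ f s) := by
      have := hη1 s hs0 hsd
      gcongr
      linarith
    have h10 : A s ≤ A s / 2 + Real.pi / (4 * A s) * (2 * (s ^ 2 * areaDensity J₀ f s)) := by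
      have h11 : 2 * Real.pi * (A s / (4 * Real.pi)) = A s / 2 := by field_simp; norm_num
      rw [h11] at h2
      refine h2.trans ?_
      gcongr
      exact h1.trans h9
    have h12 : A s / 2 ≤ Real.pi / (4 * A s) * (2 * (s ^ 2 * areaDensity J₀ f s)) := by linarith
    have h13 := mul_le_mul_of_nonneg_left h12 (by positivity : 0 ≤ 2 * A s)
    have h14 : 2 * A s * (Real.pi / (4 * A s) * (2 * (s ^ 2 * areaDensity J₀ f s))) =
        Real.pi * (s * (s * areaDensity J₀ f s)) := by field_simp; ring
    rw [h14] at h13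
    nlinarith
  have hder : ∀ s ∈ Icc r (2 * r), HasDerivAt (fun s => -(A s)⁻¹)
      (-(-(s * areaDensity J₀ f s) / A s ^ 2)) s := fun s hs =>
    ((hasDerivAt_area hJ hf (by
      rw [abs_of_nonneg (hr0.le.trans hs.1)]; exact hs.2.trans_lt hr)).inv (hApos s hs).ne').neg
  -- By `hkey`, `A² ≤ π s A' ≤ 2π r A'`, that is, `(-1/A)' ≥ 1/(2πr)`. Integrating over an interval
  -- of length `r` bounds `1/A(r)` below by `1/(2π)`, whatever the size of `A(2r)`.
  have hmv := (convex_Icc r (2 * r)).mul_sub_le_image_sub_of_le_deriv (f := fun s => -(A s)⁻¹)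
    (C := 1 / (2 * Real.pi * r))
    (fun s hs => (hder s hs).continuousAt.continuousWithinAt)
    (fun s hs => (hder s (interior_subset hs)).differentiableAt.differentiableWithinAt)
    (fun s hs => by
      have hs := interior_subset hs
      rw [(hder s hs).deriv, neg_div, neg_neg]
      have hs0 : 0 < s := hr0.trans_le hs.1
      have h1 := hkey s hs
      have h2 := hApos s hs
      rw [div_le_div_iff₀ (by positivity) (by positivity), one_mul]
      refine h1.trans ?_
      have h3 : 0 ≤ s * areaDensity J₀ f s :=
        mul_nonneg hs0.le (areaDensity_nonneg hJ hη hs0.le (hs.2.trans_lt hr)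
          (hη1' s hs0.le (hs.2.trans_lt hr)))
      have h4 : s * (s * areaDensity J₀ f s) ≤ 2 * r * (s * areaDensity J₀ f s) := by
        gcongr; exact hs.2
      nlinarith)
    r ⟨le_rfl, by linarith⟩ (2 * r) ⟨by linarith, le_rfl⟩ (by linarith)
  have h2 : 0 < A (2 * r) := hApos _ ⟨by linarith, le_rfl⟩
  have h3 : 1 / (2 * Real.pi * r) * (2 * r - r) = (2 * Real.pi)⁻¹ := by field_simp; ring
  rw [h3] at hmv
  have h4 : (2 * Real.pi)⁻¹ ≤ (A r)⁻¹ := by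
    have := inv_pos.2 h2
    linarith
  exact (inv_le_inv₀ (by positivity) hpos).1 h4

/-- Such a `T` is conformal: `T 1` and `J₀ (T 1)` are orthogonal and have the same norm. -/
theorem norm_fderiv_circleMap_eq (hJ : IsOrthogonalComplexStructure J₀)
    {T : ℂ →L[ℝ] EuclideanSpace ℝ ι}
    (hT : T I = J₀ (T 1)) (θ : ℝ) : ‖T (circleMap 0 1 θ)‖ = ‖T 1‖ := by
  have h1 : circleMap 0 1 θ = Real.cos θ • (1 : ℂ) + Real.sin θ • I := by
    simp [circleMap, exp_mul_I]
  have h2 : ‖T (circleMap 0 1 θ)‖ ^ 2 = ‖T 1‖ ^ 2 := by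
    rw [h1, map_add, map_smul, map_smul, hT, norm_add_sq_real, norm_smul, norm_smul,
      real_inner_smul_left, real_inner_smul_right, real_inner_comm, hJ.inner_self, hJ.norm_map,
      Real.norm_eq_abs, Real.norm_eq_abs, mul_pow, mul_pow, sq_abs, sq_abs]
    have := Real.sin_sq_add_cos_sq θ
    linear_combination ‖T 1‖ ^ 2 * this
  exact (pow_left_inj₀ (norm_nonneg _) (norm_nonneg _) two_ne_zero).1 h2

/-- This is the starting value for the monotonicity of `A / r²`. The defect vanishes at 0, so the
differential there is conformal; by continuity the density stays above half of its value at the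
centre. -/
theorem norm_sq_mul_le_area_of_small (hJ : IsOrthogonalComplexStructure J₀)
    (hf : ContDiffOn ℝ 1 f (ball 0 d)) (hd : 0 < d) {L : ℝ} (hL : 0 ≤ L)
    (hη : IsAlmostHolOn J₀ f d (fun r => L * r)) :
    ∃ δ > 0, δ ≤ d ∧ ∀ s, 0 ≤ s → s < δ →
      Real.pi / 2 * ‖fderiv ℝ f 0 1‖ ^ 2 * s ^ 2 ≤ formIntegral (areaForm J₀) f s := by
  set N := ‖fderiv ℝ f 0 1‖ with hN
  have h0 : (0 : ℂ) ∈ ball (0 : ℂ) d := mem_ball_self hd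
  have hcont : ContinuousAt (fderiv ℝ f) 0 :=
    (hf.continuousOn_fderiv_of_isOpen isOpen_ball le_rfl).continuousAt (isOpen_ball.mem_nhds h0)
  have hT : fderiv ℝ f 0 I = J₀ (fderiv ℝ f 0 1) := by
    have h := hη 0 h0 1
    simp only [norm_zero, mul_zero, zero_mul, mul_one] at h
    exact sub_eq_zero.1 (norm_le_zero_iff.1 h)
  -- If `N = 0`, continuity cannot provide the tolerance `N / 10`, but the lower bound is then
  -- trivial.
  obtain ⟨δ, hδ0, hδd, hδL, hδ⟩ : ∃ δ > 0, δ ≤ d ∧ L * δ ≤ 1 / 10 ∧ ∀ z ∈ ball (0 : ℂ) δ,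
      N = 0 ∨ ‖fderiv ℝ f z - fderiv ℝ f 0‖ ≤ N / 10 := by
    have hδ₂ : ∃ δ₂ > 0, L * δ₂ ≤ 1 / 10 := by
      refine ⟨1 / (10 * (L + 1)), by positivity, ?_⟩
      rw [mul_one_div, div_le_div_iff₀ (by positivity) (by positivity)]
      linarith
    obtain ⟨δ₂, hδ₂0, hδ₂⟩ := hδ₂
    rcases eq_or_lt_of_le (norm_nonneg (fderiv ℝ f 0 1)) with h | h
    · refine ⟨min d δ₂, lt_min hd hδ₂0, min_le_left _ _, ?_, fun z _ => Or.inl h.symm⟩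
      exact (mul_le_mul_of_nonneg_left (min_le_right _ _) hL).trans hδ₂
    · obtain ⟨δ₁, hδ₁0, hδ₁⟩ := Metric.continuousAt_iff.1 hcont (N / 10) (by positivity)
      refine ⟨min d (min δ₁ δ₂), lt_min hd (lt_min hδ₁0 hδ₂0), min_le_left _ _, ?_,
        fun z hz => Or.inr ?_⟩
      · exact (mul_le_mul_of_nonneg_left ((min_le_right _ _).trans (min_le_right _ _)) hL).trans hδ₂
      · rw [← dist_eq_norm]
        exact (hδ₁ (lt_of_lt_of_le hz ((min_le_right _ _).trans (min_le_left _ _)))).le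
  have hdens : ∀ s, 0 ≤ s → s < δ → Real.pi * N ^ 2 ≤ areaDensity J₀ f s := by
    intro s hs0 hs
    have hsd : |s| < d := by rw [abs_of_nonneg hs0]; linarith
    have hX := continuous_fderiv_circle hf hsd (w := fun θ => circleMap 0 1 θ) (by fun_prop)
    have hY := continuous_fderiv_circle hf hsd (w := fun θ => I * circleMap 0 1 θ) (by fun_prop)
    have h1 : ∫ θ in (0 : ℝ)..2 * Real.pi, N ^ 2 / 2 = Real.pi * N ^ 2 := by
      rw [intervalIntegral.integral_const, smul_eq_mul]; ring
    rw [← h1]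
    refine intervalIntegral.integral_mono_on (by positivity)
      (continuous_const.intervalIntegrable _ _)
      (Continuous.intervalIntegrable (by fun_prop) _ _) fun θ _ => ?_
    have hz : circleMap 0 s θ ∈ ball (0 : ℂ) δ :=
      circleMap_mem_ball (by rwa [abs_of_nonneg hs0]) θ
    have h2 := hη _ (ball_subset_ball hδd hz) (circleMap 0 1 θ)
    have hz' : ‖circleMap 0 s θ‖ < δ := by simpa using hz
    have h3 := (abs_le.1 (hJ.abs_inner_sub_le h2)).1
    set X := fderiv ℝ f (circleMap 0 s θ) (circleMap 0 1 θ) with hXdef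
    have h4 : L * ‖circleMap 0 s θ‖ ≤ 1 / 10 :=
      (mul_le_mul_of_nonneg_left hz'.le hL).trans hδL
    have h5 : 9 / 10 * ‖X‖ ^ 2 ≤
        inner ℝ (J₀ X) (fderiv ℝ f (circleMap 0 s θ) (I * circleMap 0 1 θ)) := by
      nlinarith [sq_nonneg ‖X‖]
    refine le_trans ?_ h5
    rcases hδ _ hz with hN0 | hz2
    · rw [hN0]
      nlinarith [sq_nonneg ‖X‖]
    · have h6 : N - N / 10 ≤ ‖X‖ := by
        have h7 : ‖fderiv ℝ f 0 (circleMap 0 1 θ)‖ = N := norm_fderiv_circleMap_eq hJ hT θ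
        have h8 : ‖X - fderiv ℝ f 0 (circleMap 0 1 θ)‖ ≤ N / 10 := by
          rw [hXdef, ← sub_apply]
          refine (ContinuousLinearMap.le_opNorm _ _).trans ?_
          rw [norm_circleMap_one, mul_one]
          exact hz2
        have h9 := norm_le_norm_add_norm_sub X (fderiv ℝ f 0 (circleMap 0 1 θ))
        linarith
      have h10 : 0 ≤ N := norm_nonneg _
      nlinarith
  refine ⟨δ, hδ0, hδd, fun s hs0 hs => ?_⟩
  have hder : ∀ r ∈ Ico 0 δ, HasDerivAt
      (fun r => formIntegral (areaForm J₀) f r - Real.pi / 2 * N ^ 2 * r ^ 2)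
      (r * areaDensity J₀ f r - Real.pi / 2 * N ^ 2 * (2 * r)) r := by
    intro r hr
    have h1 := (hasDerivAt_pow 2 r).const_mul (Real.pi / 2 * N ^ 2)
    have h2 := (hasDerivAt_area hJ hf (r := r) (by
      rw [abs_of_nonneg hr.1]; exact hr.2.trans_le hδd)).sub h1
    refine h2.congr_deriv ?_
    norm_num
  have hmono : MonotoneOn (fun r => formIntegral (areaForm J₀) f r - Real.pi / 2 * N ^ 2 * r ^ 2)
      (Ico 0 δ) := by
    refine monotoneOn_of_hasDerivWithinAt_nonneg (convex_Ico 0 δ)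
      (fun r hr => (hder r hr).continuousAt.continuousWithinAt)
      (fun r hr => (hder r (interior_subset hr)).hasDerivWithinAt) fun r hr => ?_
    have hr := interior_subset hr
    nlinarith [mul_le_mul_of_nonneg_left (hdens r hr.1 hr.2) hr.1]
  have h := hmono ⟨le_rfl, hδ0⟩ ⟨hs0, hs⟩ hs0
  simp only [formIntegral_zero] at h
  norm_num at h
  linarith

/-- **Monotonicity of area**: the derivative at the centre is controlled by the area, for discs
whose defect of holomorphy vanishes linearly at the centre. -/
theorem norm_sq_mul_le_area (hJ : IsOrthogonalComplexStructure J₀)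
    (hf : ContDiffOn ℝ 1 f (ball 0 d)) {L : ℝ} (hL : 0 ≤ L)
    (hη : IsAlmostHolOn J₀ f d (fun r => L * r)) {r : ℝ} (hr0 : 0 < r) (hr : r < d)
    (hLr : L * r ≤ 1 / 2) :
    Real.pi / 2 * ‖fderiv ℝ f 0 1‖ ^ 2 * r ^ 2 ≤
      Real.exp (14 * (L * r)) * formIntegral (areaForm J₀) f r := by
  set A := formIntegral (areaForm J₀) f with hA
  obtain ⟨δ, hδ0, hδd, hδ⟩ := norm_sq_mul_le_area_of_small hJ hf (hr0.trans hr) hL hη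
  have hηr : ∀ s ∈ Ioc 0 r, L * s ≤ 1 / 2 := fun s hs =>
    (mul_le_mul_of_nonneg_left hs.2 hL).trans hLr
  have hA0 : ∀ s ∈ Icc 0 r, 0 ≤ A s := by
    have hder : ∀ s ∈ Icc 0 r, HasDerivAt A (s * areaDensity J₀ f s) s := fun s hs =>
      hasDerivAt_area hJ hf (by rw [abs_of_nonneg hs.1]; exact hs.2.trans_lt hr)
    have hmono : MonotoneOn A (Icc 0 r) := by
      refine monotoneOn_of_hasDerivWithinAt_nonneg (convex_Icc 0 r)
        (fun s hs => (hder s hs).continuousAt.continuousWithinAt)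
        (fun s hs => (hder s (interior_subset hs)).hasDerivWithinAt) fun s hs => ?_
      have hs := interior_subset hs
      refine mul_nonneg hs.1 (areaDensity_nonneg hJ hη hs.1 (hs.2.trans_lt hr) ?_)
      have := mul_le_mul_of_nonneg_left hs.2 hL
      linarith
    intro s hs
    have := hmono ⟨le_rfl, hr0.le⟩ hs hs.1
    rwa [hA, formIntegral_zero] at this
  have hder : ∀ s ∈ Ioc 0 r, HasDerivAt (fun s => Real.exp (14 * (L * s)) * A s / s ^ 2)
      (((Real.exp (14 * (L * s)) * (14 * (L * 1)) * A s +
        Real.exp (14 * (L * s)) * (s * areaDensity J₀ f s)) * s ^ 2 -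
          Real.exp (14 * (L * s)) * A s * (2 * s)) / (s ^ 2) ^ 2) s := by
    intro s hs
    have h1 := ((((hasDerivAt_id s).const_mul L).const_mul 14).exp).mul
      (hasDerivAt_area hJ hf (r := s) (by rw [abs_of_pos hs.1]; exact hs.2.trans_lt hr))
    have h2 := h1.div (hasDerivAt_pow 2 s) (pow_ne_zero 2 hs.1.ne')
    refine h2.congr_deriv ?_
    simp only [id, Pi.mul_apply, hA]
    norm_num
  have hmono : MonotoneOn (fun s => Real.exp (14 * (L * s)) * A s / s ^ 2) (Ioc 0 r) := by
    refine monotoneOn_of_hasDerivWithinAt_nonneg (convex_Ioc 0 r)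
      (fun s hs => (hder s hs).continuousAt.continuousWithinAt)
      (fun s hs => (hder s (interior_subset hs)).hasDerivWithinAt) fun s hs => ?_
    have hs := interior_subset hs
    have hs0 := hs.1
    have h1 := area_le hJ hf hη hs.1.le (hs.2.trans_lt hr) (by positivity) (hηr s hs)
    have h2 : 0 ≤ A s := hA0 s ⟨hs.1.le, hs.2⟩
    have h3 : 0 ≤ L * s := by positivity
    have h4 := areaDensity_nonneg hJ hη hs.1.le (hs.2.trans_lt hr)
      ((hηr s hs).trans (by norm_num))
    -- With `x = 7Ls`: if `x ≥ 1`, the first term alone absorbs `2A`; otherwise `(2 - 2x) A ≤ (1 -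
    -- x)(1 + x) s² areaDensity ≤ s² areaDensity`.
    have h5 : 0 ≤ 14 * (L * s) * A s + s ^ 2 * areaDensity J₀ f s - 2 * A s := by
      have h6 : 0 ≤ s ^ 2 * areaDensity J₀ f s := by positivity
      rcases le_or_gt (1 / 7) (L * s) with h7 | h7
      · nlinarith
      · nlinarith [mul_nonneg (mul_nonneg h3 h3) h6]
    refine div_nonneg ?_ (by positivity)
    have h8 : (Real.exp (14 * (L * s)) * (14 * (L * 1)) * A s +
        Real.exp (14 * (L * s)) * (s * areaDensity J₀ f s)) * s ^ 2 -
          Real.exp (14 * (L * s)) * A s * (2 * s) = Real.exp (14 * (L * s)) * s *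
        (14 * (L * s) * A s + s ^ 2 * areaDensity J₀ f s - 2 * A s) := by ring
    rw [h8]
    positivity
  set s := min r (δ / 2) with hs
  have hs0 : 0 < s := lt_min hr0 (by positivity)
  have hsδ : s < δ := (min_le_right _ _).trans_lt (by linarith)
  have h1 := hδ s hs0.le hsδ
  have h2 := hmono ⟨hs0, min_le_left _ _⟩ ⟨hr0, le_rfl⟩ (min_le_left _ _)
  simp only at h2
  rw [← le_div_iff₀ (by positivity)] at h1 ⊢
  refine h1.trans (le_trans ?_ h2)
  gcongr
  refine le_mul_of_one_le_left (hA0 s ⟨hs0.le, min_le_left _ _⟩) ?_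
  exact Real.one_le_exp (by positivity)

end Area

/-! ### Consequences of the `C¹` norm and of strict plurisubharmonicity. -/

section Structure

variable {n : ℕ}

theorem Jst_apply (x : E n) : Jst n x = WithLp.toLp 2 (Sum.elim (fun i => -x (Sum.inr i))
    (fun i => x (Sum.inl i))) := by
  ext i
  simp only [Jst, Matrix.J, Matrix.ofLp_toEuclideanCLM]
  rcases i with i | i <;>
    simp [Matrix.mulVec, dotProduct, Matrix.one_apply, Fintype.sum_sum_type]

theorem isOrthogonalComplexStructure_Jst : IsOrthogonalComplexStructure (Jst n) where
  norm_map x := by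
    rw [EuclideanSpace.norm_eq, EuclideanSpace.norm_eq, Jst_apply]
    congr 1
    simp only [Fintype.sum_sum_type, Sum.elim_inl, Sum.elim_inr, norm_neg]
    ring
  sq_eq x := by
    ext i
    rcases i with i | i <;> simp [Jst_apply]

variable {H : E n → (E n →L[ℝ] E n)} {p : E n}

theorem inner_derivMatrix (hH : DifferentiableAt ℝ H p) (i : Fin n ⊕ Fin n) (X Y : E n) :
    inner ℝ X (Matrix.toEuclideanCLM (𝕜 := ℝ) (derivMatrix H p i) Y) = (fderiv ℝ H p Y X) i := by
  have hentry : ∀ j k, derivMatrix H p i j k =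
      (fderiv ℝ H p (EuclideanSpace.single k 1) (EuclideanSpace.single j 1)) i := by
    intro j k
    have h1 : HasFDerivAt (fun x => (H x (EuclideanSpace.single j 1)) i)
        ((EuclideanSpace.proj (𝕜 := ℝ) i).comp
          ((ContinuousLinearMap.apply ℝ (E n) (EuclideanSpace.single j (1 : ℝ))).comp
            (fderiv ℝ H p))) p :=
      (EuclideanSpace.proj (𝕜 := ℝ) i).hasFDerivAt.comp p
        ((ContinuousLinearMap.apply ℝ (E n) (EuclideanSpace.single j (1 : ℝ))).hasFDerivAt.comp p
          hH.hasFDerivAt)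
    simp only [derivMatrix, Matrix.of_apply, h1.fderiv]
    rfl
  have hsum : ∀ Z : E n, Z = ∑ j, Z j • EuclideanSpace.single j (1 : ℝ) := by
    intro Z
    ext j
    simp [Finset.sum_apply, Pi.single_apply, -Fintype.sum_sum_type]
  conv_rhs => rw [hsum X, hsum Y]
  simp only [map_sum, map_smul, sum_apply, smul_apply,
    PiLp.inner_apply, Matrix.ofLp_toEuclideanCLM, Matrix.mulVec, dotProduct, hentry]
  simp [Finset.mul_sum, Finset.sum_apply, mul_comm, -Fintype.sum_sum_type]

/-- Component `i` of `(D_Y H) X` is the bilinear form of `derivMatrix H p i`. Summing the squares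
over `i` gives the operator norm with a constant independent of the dimension. -/
theorem norm_fderiv_le_pointNorm (hH : DifferentiableAt ℝ H p) :
    ‖fderiv ℝ H p‖ ≤ pointNorm H p := by
  set S := √(∑ i, ‖Matrix.toEuclideanCLM (𝕜 := ℝ) (derivMatrix H p i)‖ ^ 2) with hS
  have hS0 : 0 ≤ S := Real.sqrt_nonneg _
  have hS2 : S ^ 2 = ∑ i, ‖Matrix.toEuclideanCLM (𝕜 := ℝ) (derivMatrix H p i)‖ ^ 2 :=
    Real.sq_sqrt (by positivity)
  have h : ‖fderiv ℝ H p‖ ≤ S := by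
    refine ContinuousLinearMap.opNorm_le_bound₂ _ hS0 fun Y X => ?_
    refine (sq_le_sq₀ (norm_nonneg _) (by positivity)).1 ?_
    rw [EuclideanSpace.real_norm_sq_eq, mul_pow, mul_pow, hS2, Finset.sum_mul, Finset.sum_mul]
    refine Finset.sum_le_sum fun i _ => ?_
    rw [← inner_derivMatrix hH, ← mul_pow, ← mul_pow, sq_le_sq]
    refine (abs_real_inner_le_norm _ _).trans ?_
    rw [abs_of_nonneg (by positivity)]
    calc _ ≤ ‖X‖ * (‖Matrix.toEuclideanCLM (𝕜 := ℝ) (derivMatrix H p i)‖ * ‖Y‖) := by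
          gcongr; exact ContinuousLinearMap.le_opNorm _ _
      _ = _ := by ring
  exact h.trans (le_add_of_nonneg_left (norm_nonneg _))

theorem norm_derivMatrix_le (hH : DifferentiableAt ℝ H p) (i : Fin n ⊕ Fin n) :
    ‖Matrix.toEuclideanCLM (𝕜 := ℝ) (derivMatrix H p i)‖ ≤ ‖fderiv ℝ H p‖ := by
  refine ContinuousLinearMap.opNorm_le_bound _ (norm_nonneg (fderiv ℝ H p)) fun Y => ?_
  set Z := Matrix.toEuclideanCLM (𝕜 := ℝ) (derivMatrix H p i) Y with hZ
  have h1 : ‖Z‖ ^ 2 ≤ ‖fderiv ℝ H p‖ * ‖Y‖ * ‖Z‖ := by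
    rw [← real_inner_self_eq_norm_sq]
    conv_lhs => rw [hZ, inner_derivMatrix hH]
    refine (le_abs_self _).trans ?_
    rw [← Real.norm_eq_abs]
    exact (PiLp.norm_apply_le _ i).trans (ContinuousLinearMap.le_opNorm₂ _ _ _)
  rcases eq_or_lt_of_le (norm_nonneg Z) with h0 | h0
  · rw [← h0]; positivity
  · nlinarith

/-- This bound depends on the dimension. It only serves to show that the supremum defining `normC1`
is over a bounded set, so no universal constant is affected. -/
theorem pointNorm_le (hH : DifferentiableAt ℝ H p) :
    pointNorm H p ≤ ‖H p‖ + √(∑ _i : Fin n ⊕ Fin n, ‖fderiv ℝ H p‖ ^ 2) := by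
  unfold pointNorm
  gcongr with i
  exact norm_derivMatrix_le hH i

/-- A map of class `C^k` up to the boundary of a bounded set has bounded derivatives. -/
theorem ContDiffOnClosure.exists_bound {V W : Type*} [NormedAddCommGroup V] [NormedSpace ℝ V]
    [ProperSpace V] [NormedAddCommGroup W] [NormedSpace ℝ W] {k : ℕ} {f : V → W} {D : Set V}
    (hf : ContDiffOnClosure k f D) (hD : Bornology.IsBounded D) {m : ℕ} (hm : m ≤ k) :
    ∃ C, ∀ x ∈ D, ‖iteratedFDeriv ℝ m f x‖ ≤ C := by
  obtain ⟨g, hgc, hg⟩ := hf.2 m hm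
  obtain ⟨C, hC⟩ := hD.isCompact_closure.exists_bound_of_continuousOn hgc
  exact ⟨C, fun x hx => hg hx ▸ hC x (subset_closure hx)⟩

variable {D : Set (E n)} {J : E n → (E n →L[ℝ] E n)} {ε : ℝ}

theorem IsAlmostComplexOn.differentiableAt (hJ : IsAlmostComplexOn J D) (hD : IsOpen D) {x : E n}
    (hx : x ∈ D) : DifferentiableAt ℝ J x :=
  (hJ.contDiff.1.differentiableOn one_ne_zero).differentiableAt (hD.mem_nhds hx)

theorem pointNorm_le_normC1 (hD : IsOpen D) (hDb : Bornology.IsBounded D)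
    (hJ : IsAlmostComplexOn J D) {x : E n} (hx : x ∈ D) :
    pointNorm (fun x => J x - Jst n) x ≤ normC1 D (fun x => J x - Jst n) := by
  refine le_csSup ?_ (mem_image_of_mem _ hx)
  obtain ⟨C₀, hC₀⟩ := hJ.contDiff.exists_bound hDb (Nat.zero_le 1)
  obtain ⟨C₁, hC₁⟩ := hJ.contDiff.exists_bound hDb le_rfl
  refine ⟨C₀ + ‖Jst n‖ + √(∑ _i : Fin n ⊕ Fin n, C₁ ^ 2), ?_⟩
  rintro _ ⟨y, hy, rfl⟩
  have h0 := hC₀ y hy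
  have h1 := hC₁ y hy
  rw [norm_iteratedFDeriv_zero] at h0
  rw [norm_iteratedFDeriv_one] at h1
  refine (pointNorm_le ((hJ.differentiableAt hD hy).sub_const _)).trans ?_
  rw [fderiv_sub_const]
  gcongr
  exact (norm_sub_le _ _).trans (by gcongr)

theorem norm_sub_Jst_le (hD : IsOpen D) (hDb : Bornology.IsBounded D)
    (hJ : IsAlmostComplexOn J D) (hε : normC1 D (fun x => J x - Jst n) ≤ ε) {x : E n}
    (hx : x ∈ D) : ‖J x - Jst n‖ ≤ ε := by
  refine le_trans ?_ ((pointNorm_le_normC1 hD hDb hJ hx).trans hε)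
  exact le_add_of_nonneg_right (Real.sqrt_nonneg _)

theorem norm_fderiv_le (hD : IsOpen D) (hDb : Bornology.IsBounded D)
    (hJ : IsAlmostComplexOn J D) (hε : normC1 D (fun x => J x - Jst n) ≤ ε) {x : E n}
    (hx : x ∈ D) : ‖fderiv ℝ J x‖ ≤ ε := by
  refine le_trans ?_ ((pointNorm_le_normC1 hD hDb hJ hx).trans hε)
  have := norm_fderiv_le_pointNorm ((hJ.differentiableAt hD hx).sub_const (Jst n))
  rwa [fderiv_sub_const] at this

variable {u : E n → ℝ}

theorem levi_smul (c : ℝ) (x X : E n) : levi J u x (c • X) = c ^ 2 * levi J u x X := by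
  simp only [levi, map_smul, smul_apply, smul_eq_mul]
  ring

theorem lambda0_mul_le_levi (hu : StrictlyPsh D J u) {x : E n} (hx : x ∈ D) (X : E n) :
    lambda0 D J u * ‖X‖ ^ 2 ≤ levi J u x X := by
  rcases eq_or_ne X 0 with rfl | hX
  · simp [levi]
  -- The infimum of a set unbounded below is 0 by convention, which positivity of `lambda0`
  -- excludes.
  have hbdd : BddBelow {r : ℝ | ∃ x ∈ D, ∃ X : E n, ‖X‖ = 1 ∧ r = levi J u x X} := by
    by_contra h
    have h1 : 0 < lambda0 D J u := hu
    rw [lambda0, Real.sInf_of_not_bddBelow h] at h1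
    exact lt_irrefl _ h1
  have hX' : ‖X‖ ≠ 0 := norm_ne_zero_iff.2 hX
  have h1 : lambda0 D J u ≤ levi J u x (‖X‖⁻¹ • X) :=
    csInf_le hbdd ⟨x, hx, _, by rw [norm_smul, norm_inv, norm_norm, inv_mul_cancel₀ hX'], rfl⟩
  rw [levi_smul] at h1
  calc lambda0 D J u * ‖X‖ ^ 2 ≤ ‖X‖⁻¹ ^ 2 * levi J u x X * ‖X‖ ^ 2 := by gcongr
    _ = levi J u x X := by field_simp

theorem contDiffOn_dc (hD : IsOpen D) (hJ : IsAlmostComplexOn J D) (hu : ContDiffOnClosure 2 u D) :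
    ContDiffOn ℝ 1 (dc J u) D :=
  ((hu.1.fderiv_of_isOpen hD (m := 1) (by norm_num)).clm_comp hJ.contDiff.1).neg

end Structure

/-! ### Plurisubharmonic functions along holomorphic discs. -/

section Discs

variable {n : ℕ} {D : Set (E n)} {J : E n → (E n →L[ℝ] E n)} {u : E n → ℝ} {f : ℂ → E n} {d : ℝ}

/-- `f` is a `J`-holomorphic map from the disc of radius `d` centred at `0` to `D`. -/
structure IsHolOn (D : Set (E n)) (J : E n → (E n →L[ℝ] E n)) (f : ℂ → E n) (d : ℝ) : Prop where
  contDiffOn : ContDiffOn ℝ 1 f (ball 0 d)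
  mapsTo : MapsTo f (ball 0 d) D
  hol : ∀ z ∈ ball (0 : ℂ) d, ∀ w : ℂ, fderiv ℝ f z (I * w) = J (f z) (fderiv ℝ f z w)

theorem IsHolOn.mono (hf : IsHolOn D J f d) {d' : ℝ} (hd : d' ≤ d) : IsHolOn D J f d' where
  contDiffOn := hf.contDiffOn.mono (ball_subset_ball hd)
  mapsTo := hf.mapsTo.mono_left (ball_subset_ball hd)
  hol z hz := hf.hol z (ball_subset_ball hd hz)

theorem IsHolDisc.isHolOn_comp_add {h : ℂ → E n} (hh : IsHolDisc D J h) (ζ : ℂ) :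
    IsHolOn D J (fun z => h (ζ + z)) (1 - ‖ζ‖) := by
  have hmaps : MapsTo (fun z => ζ + z) (ball (0 : ℂ) (1 - ‖ζ‖)) (ball 0 1) := by
    intro z hz
    rw [mem_ball_zero_iff] at hz ⊢
    exact (norm_add_le _ _).trans_lt (by linarith)
  refine ⟨hh.contDiffOn.comp (by fun_prop) hmaps, hh.mapsTo.comp hmaps, fun z hz w => ?_⟩
  rw [fderiv_comp_add_left]
  exact hh.hol _ (hmaps hz) w

theorem IsHolDisc.isHolOn {h : ℂ → E n} (hh : IsHolDisc D J h) : IsHolOn D J h 1 :=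
  ⟨hh.contDiffOn, hh.mapsTo, hh.hol⟩

/-- The radial energy of `f` on the circle of radius `r`. -/
def radialEnergy (f : ℂ → E n) (r : ℝ) : ℝ :=
  ∫ θ in (0 : ℝ)..2 * Real.pi, ‖fderiv ℝ f (circleMap 0 r θ) (circleMap 0 1 θ)‖ ^ 2

theorem radialEnergy_nonneg (f : ℂ → E n) (r : ℝ) : 0 ≤ radialEnergy f r :=
  intervalIntegral.integral_nonneg (by positivity) fun _ _ => by positivity

theorem lambda0_mul_radialEnergy_le (hD : IsOpen D) (hJ : IsAlmostComplexOn J D)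
    (hu : ContDiffOnClosure 2 u D) (hpsh : StrictlyPsh D J u) (hf : IsHolOn D J f d) {r : ℝ}
    (hr : |r| < d) :
    lambda0 D J u * radialEnergy f r ≤ extDerivIntegral (dc J u) f r := by
  have hX := continuous_fderiv_circle hf.contDiffOn hr (w := fun θ => circleMap 0 1 θ) (by fun_prop)
  have hY := continuous_fderiv_circle hf.contDiffOn hr (w := fun θ => I * circleMap 0 1 θ)
    (by fun_prop)
  have hα : Continuous fun θ : ℝ => fderiv ℝ (dc J u) (f (circleMap 0 r θ)) :=
    ((contDiffOn_dc hD hJ hu).continuousOn_fderiv_of_isOpen hD le_rfl).comp_continuous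
      (continuous_comp_circleMap hf.contDiffOn.continuousOn hr)
      fun θ => hf.mapsTo (circleMap_mem_ball hr θ)
  rw [radialEnergy, ← intervalIntegral.integral_const_mul, extDerivIntegral]
  refine intervalIntegral.integral_mono_on (by positivity)
    (Continuous.intervalIntegrable (by fun_prop) _ _)
    (Continuous.intervalIntegrable (((hα.clm_apply hX).clm_apply hY).sub
      ((hα.clm_apply hY).clm_apply hX)) _ _) fun θ _ => ?_
  rw [hf.hol _ (circleMap_mem_ball hr θ)]
  exact lambda0_mul_le_levi hpsh (hf.mapsTo (circleMap_mem_ball hr θ)) _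

/-- Holomorphy turns the angular velocity into `J` of the radial one, and `-du(J J X) = du(X)`. -/
theorem formIntegral_dc (hD : IsOpen D) (hu : ContDiffOnClosure 2 u D) (hf : IsHolOn D J f d)
    {r : ℝ} (hr : |r| < d) :
    formIntegral (dc J u) f r = r * ∫ θ in (0 : ℝ)..2 * Real.pi,
      fderiv ℝ (fun z => u (f z)) (circleMap 0 r θ) (circleMap 0 1 θ) := by
  rw [formIntegral, ← intervalIntegral.integral_const_mul]
  refine intervalIntegral.integral_congr fun θ _ => ?_
  have hz := circleMap_mem_ball hr θ
  have h1 : DifferentiableAt ℝ u (f (circleMap 0 r θ)) :=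
    (hu.1.differentiableOn two_ne_zero).differentiableAt (hD.mem_nhds (hf.mapsTo hz))
  have h2 : DifferentiableAt ℝ f (circleMap 0 r θ) :=
    (hf.contDiffOn.differentiableOn one_ne_zero).differentiableAt (isOpen_ball.mem_nhds hz)
  have h3 := (h1.hasFDerivAt.comp (circleMap 0 r θ) h2.hasFDerivAt).fderiv
  have h4 : fderiv ℝ (fun z => u (f z)) (circleMap 0 r θ) =
    (fderiv ℝ u (f (circleMap 0 r θ))).comp (fderiv ℝ f (circleMap 0 r θ)) := h3
  have h5 : I * (I * circleMap 0 1 θ) = -circleMap 0 1 θ := by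
    rw [← mul_assoc, I_mul_I, neg_one_mul]
  simp only [h4, dc, neg_apply, ContinuousLinearMap.comp_apply, map_smul,
    smul_eq_mul]
  rw [← hf.hol _ hz, h5, map_neg, map_neg]
  ring

/-- The `dᶜ`-flux of `u` through circles in a holomorphic disc is bounded by `|u|` at the centre. -/
theorem formIntegral_dc_le (hD : IsOpen D) (hJ : IsAlmostComplexOn J D)
    (hu : ContDiffOnClosure 2 u D) (hneg : ∀ x ∈ D, u x < 0) (hpsh : StrictlyPsh D J u)
    (hf : IsHolOn D J f d) {r : ℝ} (hr0 : 0 < r) (hr : 2 * r < d) :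
    formIntegral (dc J u) f r ≤ 4 * Real.pi * |u (f 0)| := by
  set U := formIntegral (dc J u) f with hU
  set M : ℝ → ℝ := fun s => ∫ θ in (0 : ℝ)..2 * Real.pi, u (f (circleMap 0 s θ)) with hM
  have hUd : ∀ s ∈ Ico 0 d, HasDerivAt U (s * extDerivIntegral (dc J u) f s) s := fun s hs =>
    hasDerivAt_formIntegral hf.contDiffOn hD hf.mapsTo (contDiffOn_dc hD hJ hu)
      (by rw [abs_of_nonneg hs.1]; exact hs.2)
  have hUmono : MonotoneOn U (Ico 0 d) := by
    refine monotoneOn_of_hasDerivWithinAt_nonneg (convex_Ico 0 d)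
      (fun s hs => (hUd s hs).continuousAt.continuousWithinAt)
      (fun s hs => (hUd s (interior_subset hs)).hasDerivWithinAt) fun s hs => ?_
    have hs := interior_subset hs
    refine mul_nonneg hs.1 (le_trans ?_ (lambda0_mul_radialEnergy_le hD hJ hu hpsh hf
      (by rw [abs_of_nonneg hs.1]; exact hs.2)))
    exact mul_nonneg (le_of_lt hpsh) (radialEnergy_nonneg f s)
  have hUnn : ∀ s ∈ Ico 0 d, 0 ≤ U s := fun s hs => by
    have := hUmono ⟨le_rfl, hs.1.trans_lt hs.2⟩ hs hs.1
    rwa [hU, formIntegral_zero] at this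
  set k : ℝ → ℝ := fun s => ∫ θ in (0 : ℝ)..2 * Real.pi,
    fderiv ℝ (fun z => u (f z)) (circleMap 0 s θ) (circleMap 0 1 θ) with hk
  have hMd : ∀ s ∈ Ico 0 d, HasDerivAt M (k s) s := fun s hs =>
    hasDerivAt_circle_integral ((hu.1.of_le (by norm_num)).comp hf.contDiffOn hf.mapsTo)
      (by rw [abs_of_nonneg hs.1]; exact hs.2)
  have hkU : ∀ s ∈ Ico 0 d, U s = s * k s := fun s hs =>
    formIntegral_dc hD hu hf (by rw [abs_of_nonneg hs.1]; exact hs.2)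
  have hd : 0 < d := by linarith
  have hMmono : MonotoneOn M (Icc 0 r) := by
    have hsub : Icc 0 r ⊆ Ico 0 d := fun s hs => ⟨hs.1, by linarith [hs.2]⟩
    refine monotoneOn_of_hasDerivWithinAt_nonneg (convex_Icc 0 r)
      (fun s hs => (hMd s (hsub hs)).continuousAt.continuousWithinAt)
      (fun s hs => (hMd s (hsub (interior_subset hs))).hasDerivWithinAt) fun s hs => ?_
    have hs' := interior_subset hs
    rw [interior_Icc] at hs
    have h1 := hUnn s (hsub hs')
    rw [hkU s (hsub hs')] at h1
    exact nonneg_of_mul_nonneg_right h1 hs.1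
  have hsub : Icc r (2 * r) ⊆ Ico 0 d := fun s hs => ⟨hr0.le.trans hs.1, hs.2.trans_lt hr⟩
  -- On `[r, 2r]`, `M' = U / s ≥ U(r) / (2r)`, so `M` grows by at least `U(r) / 2`. It starts from
  -- at least `M 0 = 2π u(f 0)` and ends at a value `≤ 0`.
  have hmv := (convex_Icc r (2 * r)).mul_sub_le_image_sub_of_le_deriv (f := M) (C := U r / (2 * r))
    (fun s hs => (hMd s (hsub hs)).continuousAt.continuousWithinAt)
    (fun s hs => (hMd s (hsub (interior_subset hs))).differentiableAt.differentiableWithinAt)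
    (fun s hs => by
      have hs := interior_subset hs
      rw [(hMd s (hsub hs)).deriv]
      have hs0 : 0 < s := hr0.trans_le hs.1
      have h1 : U r ≤ U s := hUmono ⟨hr0.le, by linarith⟩ (hsub hs) hs.1
      have h2 := hkU s (hsub hs)
      have h3 : 0 ≤ k s := nonneg_of_mul_nonneg_right (h2 ▸ hUnn s (hsub hs)) hs0
      rw [div_le_iff₀ (by positivity)]
      nlinarith [hs.2])
    r ⟨le_rfl, by linarith⟩ (2 * r) ⟨by linarith, le_rfl⟩ (by linarith)
  have h1 : U r / (2 * r) * (2 * r - r) = U r / 2 := by field_simp; ring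
  rw [h1] at hmv
  have h2 := hMmono ⟨le_rfl, hr0.le⟩ ⟨hr0.le, le_rfl⟩ hr0.le
  have h3 : M 0 = 2 * Real.pi * u (f 0) := by
    simp [hM]
  have h4 : M (2 * r) ≤ 0 := by
    have h5 : 0 ≤ ∫ θ in (0 : ℝ)..2 * Real.pi, -u (f (circleMap 0 (2 * r) θ)) :=
      intervalIntegral.integral_nonneg (by positivity) fun θ _ => by
        have := hneg _ (hf.mapsTo (circleMap_mem_ball (s := 2 * r) (d := d)
          (by rw [abs_of_pos (by positivity)]; exact hr) θ))
        linarith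
    rw [intervalIntegral.integral_neg] at h5
    simp only [hM]
    linarith
  rw [abs_of_neg (hneg _ (hf.mapsTo (mem_ball_self hd)))]
  linarith

end Discs

/-! ### Linear normalisation of the structure at a point. -/

section Straightening

variable {n : ℕ}

/-- A linear map close to the identity, which conjugates a complex structure `A` close to `Jst`
to `Jst`. -/
def straighten (A : E n →L[ℝ] E n) : E n →L[ℝ] E n :=
  (1 / 2 : ℝ) • (ContinuousLinearMap.id ℝ (E n) - (Jst n).comp A)

theorem straighten_apply (A : E n →L[ℝ] E n) (x : E n) :
    straighten A x = (1 / 2 : ℝ) • (x - Jst n (A x)) := by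
  simp [straighten]

/-- Both sides equal `½ (A x + Jst x)`, because `A² = Jst² = -1`. -/
theorem straighten_comp {A : E n →L[ℝ] E n} (hA : ∀ x, A (A x) = -x) (x : E n) :
    straighten A (A x) = Jst n (straighten A x) := by
  simp only [straighten_apply, hA, map_smul, map_sub, map_neg,
    isOrthogonalComplexStructure_Jst.sq_eq]
  congr 1
  abel

theorem norm_straighten_sub_le {A : E n →L[ℝ] E n} (hA : ‖A - Jst n‖ ≤ 1 / 100) (x : E n) :
    ‖straighten A x - x‖ ≤ 1 / 200 * ‖x‖ := by
  have h1 : straighten A x - x = (-(1 / 2) : ℝ) • Jst n ((A - Jst n) x) := by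
    simp only [straighten_apply, sub_apply, map_sub, isOrthogonalComplexStructure_Jst.sq_eq]
    module
  rw [h1, norm_smul, isOrthogonalComplexStructure_Jst.norm_map]
  have h2 := (A - Jst n).le_of_opNorm_le hA x
  rw [Real.norm_eq_abs, abs_neg, abs_of_pos (by norm_num)]
  linarith

theorem norm_straighten_le {A : E n →L[ℝ] E n} (hA : ‖A - Jst n‖ ≤ 1 / 100) (x : E n) :
    ‖straighten A x‖ ≤ 2 * ‖x‖ := by
  have h1 := norm_straighten_sub_le hA x
  have h2 := norm_le_norm_add_norm_sub' (straighten A x) x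
  linarith [norm_nonneg x]

theorem norm_le_norm_straighten {A : E n →L[ℝ] E n} (hA : ‖A - Jst n‖ ≤ 1 / 100) (x : E n) :
    ‖x‖ ≤ 2 * ‖straighten A x‖ := by
  have h1 := norm_straighten_sub_le hA x
  have h2 := norm_le_norm_add_norm_sub (straighten A x) x
  linarith [norm_nonneg x]

end Straightening

/-! ### Gradient estimates for holomorphic discs and the Kobayashi–Royden bound. -/

section Gradient

variable {n : ℕ} {D : Set (E n)} {J : E n → (E n →L[ℝ] E n)} {u : E n → ℝ} {f : ℂ → E n}
  {d K : ℝ}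

/-- `J` is a complex structure at each point of the open set `D`, of class `C¹` and close to the
standard structure together with its first derivatives. -/
structure IsNearlyStandardOn (J : E n → (E n →L[ℝ] E n)) (D : Set (E n)) : Prop where
  isOpen : IsOpen D
  contDiffOn : ContDiffOn ℝ 1 J D
  sq_eq : ∀ x ∈ D, ∀ X : E n, J x (J x X) = -X
  norm_sub_le : ∀ x ∈ D, ‖J x - Jst n‖ ≤ 1 / 100
  norm_fderiv_le : ∀ x ∈ D, ‖fderiv ℝ J x‖ ≤ 1 / 100

theorem IsNearlyStandardOn.norm_apply_le (hJ : IsNearlyStandardOn J D) {x : E n} (hx : x ∈ D)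
    (X : E n) : ‖J x X‖ ≤ 2 * ‖X‖ := by
  have h1 := (J x - Jst n).le_of_opNorm_le (hJ.norm_sub_le x hx) X
  rw [sub_apply] at h1
  have h2 := norm_le_norm_add_norm_sub' (J x X) (Jst n X)
  rw [isOrthogonalComplexStructure_Jst.norm_map] at h2
  linarith [norm_nonneg X]

theorem IsHolOn.isAlmostHolOn (hf : IsHolOn D J f d) (hJ : IsNearlyStandardOn J D) :
    IsAlmostHolOn (Jst n) f d (fun _ => 1 / 100) := by
  intro z hz w
  rw [hf.hol z hz, ← sub_apply]
  exact ContinuousLinearMap.le_of_opNorm_le _ (hJ.norm_sub_le _ (hf.mapsTo hz)) _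

theorem IsHolOn.norm_fderiv_le (hf : IsHolOn D J f d) (hJ : IsNearlyStandardOn J D) {z : ℂ}
    (hz : z ∈ ball (0 : ℂ) d) : ‖fderiv ℝ f z‖ ≤ 3 * ‖fderiv ℝ f z 1‖ := by
  refine ContinuousLinearMap.opNorm_le_bound _ (by positivity) fun w => ?_
  have h1 : w = w.re • (1 : ℂ) + w.im • (I * 1) := by
    simp
  have h2 : fderiv ℝ f z w = w.re • fderiv ℝ f z 1 + w.im • J (f z) (fderiv ℝ f z 1) := by
    conv_lhs => rw [h1]
    rw [map_add, map_smul, map_smul, hf.hol z hz]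
  rw [h2]
  have h3 := hJ.norm_apply_le (hf.mapsTo hz) (fderiv ℝ f z 1)
  have h4 := abs_re_le_norm w
  have h5 := abs_im_le_norm w
  have h6 := norm_nonneg (fderiv ℝ f z 1)
  calc _ ≤ ‖w.re • fderiv ℝ f z 1‖ + ‖w.im • J (f z) (fderiv ℝ f z 1)‖ := norm_add_le _ _
    _ = |w.re| * ‖fderiv ℝ f z 1‖ + |w.im| * ‖J (f z) (fderiv ℝ f z 1)‖ := by
      rw [norm_smul, norm_smul, Real.norm_eq_abs, Real.norm_eq_abs]
    _ ≤ ‖w‖ * ‖fderiv ℝ f z 1‖ + ‖w‖ * (2 * ‖fderiv ℝ f z 1‖) := by gcongr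
    _ = 3 * ‖fderiv ℝ f z 1‖ * ‖w‖ := by ring

/-- Chain rule and mean value inequality: `‖DJ‖ ≤ 1/100`, and the full differential of `f` is at
most `3K`. -/
theorem IsHolOn.norm_structure_sub_le (hf : IsHolOn D J f d) (hJ : IsNearlyStandardOn J D)
    (hK : ∀ z ∈ ball (0 : ℂ) d, ‖fderiv ℝ f z 1‖ ≤ K) {z : ℂ} (hz : z ∈ ball (0 : ℂ) d) :
    ‖J (f z) - J (f 0)‖ ≤ 3 / 100 * K * ‖z‖ := by
  have h0 : (0 : ℂ) ∈ ball (0 : ℂ) d :=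
    mem_ball_self ((norm_nonneg z).trans_lt (mem_ball_zero_iff.1 hz))
  have h := (convex_ball (0 : ℂ) d).norm_image_sub_le_of_norm_fderiv_le (𝕜 := ℝ)
    (f := fun z => J (f z)) (C := 3 / 100 * K) (x := 0) (y := z)
    (fun x hx => ((hJ.contDiffOn.comp hf.contDiffOn hf.mapsTo).differentiableOn
      one_ne_zero).differentiableAt (isOpen_ball.mem_nhds hx))
    (fun x hx => by
      have h1 : DifferentiableAt ℝ J (f x) :=
        (hJ.contDiffOn.differentiableOn one_ne_zero).differentiableAt
          (hJ.isOpen.mem_nhds (hf.mapsTo hx))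
      have h2 : DifferentiableAt ℝ f x :=
        (hf.contDiffOn.differentiableOn one_ne_zero).differentiableAt (isOpen_ball.mem_nhds hx)
      have h3 : fderiv ℝ (fun z => J (f z)) x = (fderiv ℝ J (f x)).comp (fderiv ℝ f x) :=
        fderiv_comp x h1 h2
      rw [h3]
      calc _ ≤ ‖fderiv ℝ J (f x)‖ * ‖fderiv ℝ f x‖ := ContinuousLinearMap.opNorm_comp_le _ _
        _ ≤ 1 / 100 * (3 * K) := by
          gcongr
          · exact hJ.norm_fderiv_le _ (hf.mapsTo hx)
          · exact (hf.norm_fderiv_le hJ hx).trans (by gcongr; exact hK x hx)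
        _ = 3 / 100 * K := by ring) h0 hz
  rwa [sub_zero] at h

theorem IsHolOn.fderiv_clm_comp (hf : IsHolOn D J f d) (T : E n →L[ℝ] E n) {z : ℂ}
    (hz : z ∈ ball (0 : ℂ) d) : fderiv ℝ (fun z => T (f z)) z = T.comp (fderiv ℝ f z) := by
  have h2 : DifferentiableAt ℝ f z :=
    (hf.contDiffOn.differentiableOn one_ne_zero).differentiableAt (isOpen_ball.mem_nhds hz)
  exact (T.hasFDerivAt.comp z h2.hasFDerivAt).fderiv

theorem IsHolOn.contDiffOn_clm_comp (hf : IsHolOn D J f d) (T : E n →L[ℝ] E n) :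
    ContDiffOn ℝ 1 (fun z => T (f z)) (ball 0 d) :=
  T.contDiff.comp_contDiffOn hf.contDiffOn

/-- After straightening the structure at the centre, the defect of holomorphy of a disc with
bounded derivative vanishes linearly at the centre. -/
theorem IsHolOn.isAlmostHolOn_straighten (hf : IsHolOn D J f d) (hJ : IsNearlyStandardOn J D)
    (hK : ∀ z ∈ ball (0 : ℂ) d, ‖fderiv ℝ f z 1‖ ≤ K) :
    IsAlmostHolOn (Jst n) (fun z => straighten (J (f 0)) (f z)) d (fun r => K * r) := by
  intro z hz w
  have h0 : (0 : ℂ) ∈ ball (0 : ℂ) d :=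
    mem_ball_self ((norm_nonneg z).trans_lt (mem_ball_zero_iff.1 hz))
  have hp := hf.mapsTo h0
  have hK0 : 0 ≤ K := (norm_nonneg _).trans (hK 0 h0)
  rw [hf.fderiv_clm_comp _ hz, ContinuousLinearMap.comp_apply, ContinuousLinearMap.comp_apply,
    hf.hol z hz, ← straighten_comp (hJ.sq_eq _ hp), ← map_sub, ← sub_apply]
  set Y := fderiv ℝ f z w
  have h1 := norm_straighten_le (hJ.norm_sub_le _ hp) ((J (f z) - J (f 0)) Y)
  have h2 := ContinuousLinearMap.le_of_opNorm_le _ (hf.norm_structure_sub_le hJ hK hz) Y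
  have h3 := norm_le_norm_straighten (hJ.norm_sub_le _ hp) Y
  have h4 : 0 ≤ K * ‖z‖ := by positivity
  have h5 : K * ‖z‖ * ‖Y‖ ≤ K * ‖z‖ * (2 * ‖straighten (J (f 0)) Y‖) := by gcongr
  have h6 : 0 ≤ K * ‖z‖ * ‖straighten (J (f 0)) Y‖ := by positivity
  nlinarith

/-- Undoing `straighten` costs a factor 4 in the squared derivative, hence `π / 8`; the exponent
satisfies `14 K r ≤ 7`. -/
theorem IsHolOn.norm_sq_mul_le_area (hf : IsHolOn D J f d) (hJ : IsNearlyStandardOn J D)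
    (hK : ∀ z ∈ ball (0 : ℂ) d, ‖fderiv ℝ f z 1‖ ≤ K) {r : ℝ} (hr0 : 0 < r) (hr : r < d)
    (hKr : K * r ≤ 1 / 2) :
    Real.pi / 8 * ‖fderiv ℝ f 0 1‖ ^ 2 * r ^ 2 ≤ Real.exp 7 *
      formIntegral (areaForm (Jst n)) (fun z => straighten (J (f 0)) (f z)) r := by
  have h0 : (0 : ℂ) ∈ ball (0 : ℂ) d := mem_ball_self (hr0.trans hr)
  have hK0 : 0 ≤ K := (norm_nonneg _).trans (hK 0 h0)
  have hη := hf.isAlmostHolOn_straighten hJ hK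
  have h1 := AlmostComplex.norm_sq_mul_le_area isOrthogonalComplexStructure_Jst
    (hf.contDiffOn_clm_comp _) hK0 hη hr0 hr hKr
  have h2 := norm_le_norm_straighten (hJ.norm_sub_le _ (hf.mapsTo h0)) (fderiv ℝ f 0 1)
  rw [hf.fderiv_clm_comp _ h0, ContinuousLinearMap.comp_apply] at h1
  have h3 : ‖fderiv ℝ f 0 1‖ ^ 2 ≤ 4 * ‖straighten (J (f 0)) (fderiv ℝ f 0 1)‖ ^ 2 := by
    nlinarith [norm_nonneg (fderiv ℝ f 0 1)]
  have hexp := Real.exp_pos (14 * (K * r))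
  have hA : 0 ≤ formIntegral (areaForm (Jst n)) (fun z => straighten (J (f 0)) (f z)) r := by
    refine nonneg_of_mul_nonneg_right (le_trans ?_ h1) hexp
    positivity
  calc _ ≤ Real.pi / 8 * (4 * ‖straighten (J (f 0)) (fderiv ℝ f 0 1)‖ ^ 2) * r ^ 2 := by gcongr
    _ = Real.pi / 2 * ‖straighten (J (f 0)) (fderiv ℝ f 0 1)‖ ^ 2 * r ^ 2 := by ring
    _ ≤ _ := h1
    _ ≤ _ := by
      gcongr
      linarith

theorem le_mul_of_hasDerivAt_le {F G F' G' : ℝ → ℝ} {c r : ℝ} (hr : 0 ≤ r)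
    (hF : ∀ s ∈ Icc 0 r, HasDerivAt F (F' s) s) (hG : ∀ s ∈ Icc 0 r, HasDerivAt G (G' s) s)
    (hF0 : F 0 = 0) (hG0 : G 0 = 0) (hle : ∀ s ∈ Icc 0 r, F' s ≤ c * G' s) :
    F r ≤ c * G r := by
  have hmono : MonotoneOn (fun s => c * G s - F s) (Icc 0 r) := by
    have hd : ∀ s ∈ Icc 0 r, HasDerivAt (fun s => c * G s - F s) (c * G' s - F' s) s :=
      fun s hs => ((hG s hs).const_mul c).sub (hF s hs)
    refine monotoneOn_of_hasDerivWithinAt_nonneg (convex_Icc 0 r)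
      (fun s hs => (hd s hs).continuousAt.continuousWithinAt)
      (fun s hs => (hd s (interior_subset hs)).hasDerivWithinAt) fun s hs => ?_
    linarith [hle s (interior_subset hs)]
  have h := hmono ⟨le_rfl, hr⟩ ⟨hr, le_rfl⟩ hr
  simp only [hF0, hG0] at h
  linarith

theorem IsHolOn.areaDensity_straighten_le (hf : IsHolOn D J f d) (hJ : IsNearlyStandardOn J D)
    {A : E n →L[ℝ] E n} (hA : ‖A - Jst n‖ ≤ 1 / 100) {r : ℝ} (hr : |r| < d) :
    areaDensity (Jst n) (fun z => straighten A (f z)) r ≤ 8 * radialEnergy f r := by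
  have hX := continuous_fderiv_circle hf.contDiffOn hr (w := fun θ => circleMap 0 1 θ) (by fun_prop)
  have hTX := continuous_fderiv_circle (hf.contDiffOn_clm_comp (straighten A)) hr
    (w := fun θ => circleMap 0 1 θ) (by fun_prop)
  have hTY := continuous_fderiv_circle (hf.contDiffOn_clm_comp (straighten A)) hr
    (w := fun θ => I * circleMap 0 1 θ) (by fun_prop)
  rw [areaDensity, radialEnergy, ← intervalIntegral.integral_const_mul]
  refine intervalIntegral.integral_mono_on (by positivity)
    ((((Jst n).continuous.comp hTX).inner hTY).intervalIntegrable _ _)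
    (Continuous.intervalIntegrable (by fun_prop) _ _) fun θ _ => ?_
  have hz := circleMap_mem_ball hr θ
  rw [hf.fderiv_clm_comp _ hz, ContinuousLinearMap.comp_apply, ContinuousLinearMap.comp_apply,
    hf.hol _ hz]
  set X := fderiv ℝ f (circleMap 0 r θ) (circleMap 0 1 θ)
  refine (real_inner_le_norm _ _).trans ?_
  rw [isOrthogonalComplexStructure_Jst.norm_map]
  have h1 := norm_straighten_le hA X
  have h2 := norm_straighten_le hA (J (f (circleMap 0 r θ)) X)
  have h3 := hJ.norm_apply_le (hf.mapsTo hz) X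
  calc _ ≤ (2 * ‖X‖) * (2 * (2 * ‖X‖)) := by gcongr; linarith
    _ = 8 * ‖X‖ ^ 2 := by ring

theorem IsHolOn.radialEnergy_le_areaDensity (hf : IsHolOn D J f d) (hJ : IsNearlyStandardOn J D)
    {r : ℝ} (hr : |r| < d) : radialEnergy f r ≤ 2 * areaDensity (Jst n) f r := by
  have hX := continuous_fderiv_circle hf.contDiffOn hr (w := fun θ => circleMap 0 1 θ) (by fun_prop)
  have hY := continuous_fderiv_circle hf.contDiffOn hr (w := fun θ => I * circleMap 0 1 θ)
    (by fun_prop)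
  rw [areaDensity, radialEnergy, ← intervalIntegral.integral_const_mul]
  refine intervalIntegral.integral_mono_on (by positivity)
    (Continuous.intervalIntegrable (by fun_prop) _ _)
    ((continuous_const.mul (((Jst n).continuous.comp hX).inner hY)).intervalIntegrable _ _)
    fun θ _ => ?_
  have h := (abs_le.1 (isOrthogonalComplexStructure_Jst.abs_inner_sub_le
    (hf.isAlmostHolOn hJ _ (circleMap_mem_ball hr θ) (circleMap 0 1 θ)))).1
  nlinarith [sq_nonneg ‖fderiv ℝ f (circleMap 0 r θ) (circleMap 0 1 θ)‖]

/-- The lower area bound concerns the straightened disc, while linear decay and the bound `2π` are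
applied to `f` itself. Both areas are comparable to the energy, hence to each other. -/
theorem IsHolOn.area_straighten_le (hf : IsHolOn D J f d) (hJ : IsNearlyStandardOn J D)
    {A : E n →L[ℝ] E n} (hA : ‖A - Jst n‖ ≤ 1 / 100) {r : ℝ} (hr0 : 0 ≤ r) (hr : r < d) :
    formIntegral (areaForm (Jst n)) (fun z => straighten A (f z)) r ≤
      16 * formIntegral (areaForm (Jst n)) f r := by
  have habs : ∀ s ∈ Icc 0 r, |s| < d := fun s hs => by
    rw [abs_of_nonneg hs.1]; exact hs.2.trans_lt hr
  refine le_mul_of_hasDerivAt_le hr0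
    (fun s hs => hasDerivAt_area isOrthogonalComplexStructure_Jst (hf.contDiffOn_clm_comp _)
      (habs s hs))
    (fun s hs => hasDerivAt_area isOrthogonalComplexStructure_Jst hf.contDiffOn (habs s hs))
    (formIntegral_zero _ _) (formIntegral_zero _ _) fun s hs => ?_
  have h1 := hf.areaDensity_straighten_le hJ hA (habs s hs)
  have h2 := hf.radialEnergy_le_areaDensity hJ (habs s hs)
  calc _ ≤ s * (8 * (2 * areaDensity (Jst n) f s)) := by
        refine mul_le_mul_of_nonneg_left ?_ hs.1
        linarith
    _ = _ := by ring

/-- Both sides vanish at radius 0, and their derivatives are compared through `radialEnergy`: area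
density from above, `d(d^c u)` from below. -/
theorem IsHolOn.area_straighten_le_formIntegral_dc (hf : IsHolOn D J f d)
    (hJ : IsNearlyStandardOn J D) (hJc : IsAlmostComplexOn J D) (hu : ContDiffOnClosure 2 u D)
    (hpsh : StrictlyPsh D J u) {A : E n →L[ℝ] E n} (hA : ‖A - Jst n‖ ≤ 1 / 100) {r : ℝ}
    (hr0 : 0 ≤ r) (hr : r < d) :
    formIntegral (areaForm (Jst n)) (fun z => straighten A (f z)) r ≤
      8 / lambda0 D J u * formIntegral (dc J u) f r := by
  have hl : 0 < lambda0 D J u := hpsh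
  have habs : ∀ s ∈ Icc 0 r, |s| < d := fun s hs => by
    rw [abs_of_nonneg hs.1]; exact hs.2.trans_lt hr
  refine le_mul_of_hasDerivAt_le hr0
    (fun s hs => hasDerivAt_area isOrthogonalComplexStructure_Jst (hf.contDiffOn_clm_comp _)
      (habs s hs))
    (fun s hs => hasDerivAt_formIntegral hf.contDiffOn hJ.isOpen hf.mapsTo
      (contDiffOn_dc hJ.isOpen hJc hu) (habs s hs))
    (formIntegral_zero _ _) (formIntegral_zero _ _) fun s hs => ?_
  have h1 := hf.areaDensity_straighten_le hJ hA (habs s hs)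
  have h2 := lambda0_mul_radialEnergy_le hJ.isOpen hJc hu hpsh hf (habs s hs)
  have h3 : 8 * radialEnergy f s ≤ 8 / lambda0 D J u * extDerivIntegral (dc J u) f s := by
    rw [div_mul_eq_mul_div, le_div_iff₀ hl]
    linarith
  calc _ ≤ s * (8 / lambda0 D J u * extDerivIntegral (dc J u) f s) :=
        mul_le_mul_of_nonneg_left (h1.trans h3) hs.1
    _ = _ := by ring

/-- A gradient bound at the centre of a disc on which the derivative is almost maximal at the
centre. -/
theorem IsHolOn.mul_norm_le (hf : IsHolOn D J f d) (hJ : IsNearlyStandardOn J D)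
    (hD1 : ∀ x ∈ D, ‖x‖ ≤ 1) {ρ : ℝ} (hρ0 : 0 < ρ) (hρ : ρ < d)
    (hK : ∀ z ∈ ball (0 : ℂ) (ρ / 2), ‖fderiv ℝ f z 1‖ ≤ 2 * ‖fderiv ℝ f 0 1‖) :
    ρ * ‖fderiv ℝ f 0 1‖ ≤ 2048 * Real.exp 7 := by
  set R := ‖fderiv ℝ f 0 1‖ with hR
  have hexp : 1 ≤ Real.exp 7 := Real.one_le_exp (by norm_num)
  rcases le_or_gt (ρ * R) 1 with h1 | h1
  · linarith
  have hR0 : 0 < R := by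
    by_contra h
    have : ρ * R ≤ 0 := mul_nonpos_of_nonneg_of_nonpos hρ0.le (not_lt.1 h)
    linarith
  -- The derivative is bounded by `K = 2R` near the centre, and this is the largest radius with `K r
  -- ≤ 1/2`.
  set r := 1 / (4 * R) with hr
  have hr0 : 0 < r := by positivity
  have hRr : R * r = 1 / 4 := by rw [hr]; field_simp
  have hrρ : r < ρ / 2 := by
    by_contra h
    have := mul_le_mul_of_nonneg_left (not_lt.1 h) hR0.le
    nlinarith
  have hst := isOrthogonalComplexStructure_Jst (n := n)
  have h0 : (0 : ℂ) ∈ ball (0 : ℂ) d := mem_ball_self (hρ0.trans hρ)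
  have h2 := (hf.mono (by linarith : ρ / 2 ≤ d)).norm_sq_mul_le_area hJ hK hr0 hrρ
    (by rw [mul_assoc, hRr]; norm_num)
  have h3 := hf.area_straighten_le hJ (hJ.norm_sub_le _ (hf.mapsTo h0)) hr0.le
    (by linarith : r < d)
  have h4 := area_mul_le_mul_area hst hf.contDiffOn (hf.isAlmostHolOn hJ)
    (fun _ _ _ => by norm_num) (fun _ _ _ => by norm_num) hr0 hrρ.le (by linarith)
  have h5 := area_le_two_pi hst hf.contDiffOn (hf.isAlmostHolOn hJ)
    (fun _ _ _ => by norm_num) (fun _ _ _ => by norm_num) (fun z hz => hD1 _ (hf.mapsTo hz))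
    (r := ρ / 2) (by positivity) (by linarith)
  set A := formIntegral (areaForm (Jst n)) f r
  set A' := formIntegral (areaForm (Jst n)) (fun z => straighten (J (f 0)) (f z)) r
  have h6 : A * (ρ / 2) ≤ 2 * Real.pi * r := h4.trans (by gcongr)
  have h7 : Real.pi / 8 * R ^ 2 * r ^ 2 = Real.pi / 128 := by
    have : R ^ 2 * r ^ 2 = 1 / 16 := by rw [← mul_pow, hRr]; norm_num
    rw [mul_assoc, this]; ring
  rw [h7] at h2
  have hpi := Real.pi_pos
  have h8 : Real.pi / 128 * (ρ / 2) ≤ Real.exp 7 * (16 * (2 * Real.pi * r)) := by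
    calc _ ≤ Real.exp 7 * A' * (ρ / 2) := by gcongr
      _ ≤ Real.exp 7 * (16 * A) * (ρ / 2) := by gcongr
      _ = Real.exp 7 * (16 * (A * (ρ / 2))) := by ring
      _ ≤ _ := by gcongr
  have h9 : ρ ≤ 8192 * Real.exp 7 * r := by
    refine le_of_mul_le_mul_left (a := Real.pi / 256) ?_ (by positivity)
    linarith
  calc ρ * R ≤ 8192 * Real.exp 7 * r * R := by gcongr
    _ = 8192 * Real.exp 7 * (R * r) := by ring
    _ = 2048 * Real.exp 7 := by rw [hRr]; ring

/-- An interior gradient bound for holomorphic discs in the unit ball. -/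
theorem IsHolDisc.norm_fderiv_le {h : ℂ → E n} (hh : IsHolDisc D J h)
    (hJ : IsNearlyStandardOn J D) (hD1 : ∀ x ∈ D, ‖x‖ ≤ 1) {ζ : ℂ}
    (hζ : ζ ∈ ball (0 : ℂ) (1 / 4)) : ‖fderiv ℝ h ζ 1‖ ≤ 8192 * Real.exp 7 := by
  have hsub : closedBall (0 : ℂ) (1 / 2) ⊆ ball 0 1 := closedBall_subset_ball (by norm_num)
  -- Point picking: at a maximum `ζ₀` of this weighted derivative, the weight at distance less than
  -- `(1/2 - ‖ζ₀‖)/2` drops by at most half, so the derivative there at most doubles. This is the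
  -- hypothesis of `IsHolOn.mul_norm_le` after recentring at `ζ₀`.
  have hcont : ContinuousOn (fun z : ℂ => (1 / 2 - ‖z‖) * ‖fderiv ℝ h z 1‖)
      (closedBall (0 : ℂ) (1 / 2)) := by
    have h1 := (hh.contDiffOn.continuousOn_fderiv_of_isOpen isOpen_ball le_rfl).mono hsub
    exact (by fun_prop : Continuous fun z : ℂ => 1 / 2 - ‖z‖).continuousOn.mul
      (h1.clm_apply continuousOn_const).norm
  obtain ⟨ζ₀, hζ₀, hmax⟩ := (isCompact_closedBall (0 : ℂ) (1 / 2)).exists_isMaxOn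
    (nonempty_closedBall.2 (by norm_num)) hcont
  have hζ₀' : ‖ζ₀‖ ≤ 1 / 2 := by simpa using hζ₀
  have hbound : (1 / 2 - ‖ζ₀‖) * ‖fderiv ℝ h ζ₀ 1‖ ≤ 2048 * Real.exp 7 := by
    rcases eq_or_lt_of_le hζ₀' with heq | hlt
    · rw [heq]
      simp only [sub_self, zero_mul]
      positivity
    · have h1 := (hh.isHolOn_comp_add ζ₀).mul_norm_le hJ hD1 (ρ := 1 / 2 - ‖ζ₀‖) (by linarith)
        (by linarith) (fun z hz => by
          rw [fderiv_comp_add_left, fderiv_comp_add_left, add_zero]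
          rw [mem_ball_zero_iff] at hz
          have h2 := norm_add_le ζ₀ z
          have h3 : ζ₀ + z ∈ closedBall (0 : ℂ) (1 / 2) := by
            rw [mem_closedBall_zero_iff]; linarith
          have h4 : (1 / 2 - ‖ζ₀ + z‖) * ‖fderiv ℝ h (ζ₀ + z) 1‖ ≤
            (1 / 2 - ‖ζ₀‖) * ‖fderiv ℝ h ζ₀ 1‖ := hmax h3
          have h5 : (1 / 2 - ‖ζ₀‖) / 2 * ‖fderiv ℝ h (ζ₀ + z) 1‖ ≤
              (1 / 2 - ‖ζ₀ + z‖) * ‖fderiv ℝ h (ζ₀ + z) 1‖ := by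
            gcongr; linarith
          refine le_of_mul_le_mul_left (a := (1 / 2 - ‖ζ₀‖) / 2) ?_ (by linarith)
          linarith)
      rwa [fderiv_comp_add_left, add_zero] at h1
  rw [mem_ball_zero_iff] at hζ
  have h1 : (1 / 2 - ‖ζ‖) * ‖fderiv ℝ h ζ 1‖ ≤ (1 / 2 - ‖ζ₀‖) * ‖fderiv ℝ h ζ₀ 1‖ :=
    hmax (by rw [mem_closedBall_zero_iff]; linarith)
  have h2 : 1 / 4 * ‖fderiv ℝ h ζ 1‖ ≤ (1 / 2 - ‖ζ‖) * ‖fderiv ℝ h ζ 1‖ := by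
    gcongr; linarith
  linarith

/-- The derivative at the centre of a holomorphic disc is controlled by the value at the centre of
a negative strictly plurisubharmonic function. -/
theorem IsHolDisc.norm_sq_le {h : ℂ → E n} (hh : IsHolDisc D J h)
    (hJ : IsNearlyStandardOn J D) (hD1 : ∀ x ∈ D, ‖x‖ ≤ 1) (hJc : IsAlmostComplexOn J D)
    (hu : ContDiffOnClosure 2 u D) (hneg : ∀ x ∈ D, u x < 0) (hpsh : StrictlyPsh D J u) :
    ‖fderiv ℝ h 0 1‖ ^ 2 ≤
      256 * Real.exp 7 * (16384 * Real.exp 7) ^ 2 * (|u (h 0)| / lambda0 D J u) := by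
  have hl : 0 < lambda0 D J u := hpsh
  have hexp : 1 ≤ Real.exp 7 := Real.one_le_exp (by norm_num)
  have hpi := Real.pi_pos
  -- With the gradient bound `K = 8192 e⁷` on the disc of radius `1/4`, this gives `K r = 1/2`.
  set r : ℝ := 1 / (16384 * Real.exp 7) with hr
  have hr0 : 0 < r := by positivity
  have hr4 : r < 1 / 4 := by
    rw [hr]
    exact one_div_lt_one_div_of_lt (by norm_num) (by linarith)
  have h0 : (0 : ℂ) ∈ ball (0 : ℂ) 1 := mem_ball_self one_pos
  have h1 := (hh.isHolOn.mono (by norm_num : (1 / 4 : ℝ) ≤ 1)).norm_sq_mul_le_area hJ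
    (fun z hz => hh.norm_fderiv_le hJ hD1 hz) hr0 hr4
    (by rw [hr]; field_simp; norm_num)
  have h2 := hh.isHolOn.area_straighten_le_formIntegral_dc hJ hJc hu hpsh
    (hJ.norm_sub_le _ (hh.mapsTo h0)) hr0.le (by linarith)
  have h3 := formIntegral_dc_le hJ.isOpen hJc hu hneg hpsh hh.isHolOn hr0 (by linarith)
  have h4 : Real.pi / 8 * ‖fderiv ℝ h 0 1‖ ^ 2 * r ^ 2 ≤
      Real.exp 7 * (8 / lambda0 D J u * (4 * Real.pi * |u (h 0)|)) := by
    refine h1.trans ?_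
    gcongr
    exact h2.trans (by gcongr)
  have h5 : ‖fderiv ℝ h 0 1‖ ^ 2 =
      8 / Real.pi * (16384 * Real.exp 7) ^ 2 * (Real.pi / 8 * ‖fderiv ℝ h 0 1‖ ^ 2 * r ^ 2) := by
    rw [hr]; field_simp
  rw [h5]
  calc _ ≤ 8 / Real.pi * (16384 * Real.exp 7) ^ 2 *
        (Real.exp 7 * (8 / lambda0 D J u * (4 * Real.pi * |u (h 0)|))) := by gcongr
    _ = _ := by field_simp; ring

/-- The Kobayashi–Royden pseudometric is bounded below by means of a negative strictly
plurisubharmonic function. -/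
theorem IsNearlyStandardOn.ofReal_le_kobayashi (hJ : IsNearlyStandardOn J D)
    (hD1 : ∀ x ∈ D, ‖x‖ ≤ 1) (hJc : IsAlmostComplexOn J D) (hu : ContDiffOnClosure 2 u D)
    (hneg : ∀ x ∈ D, u x < 0) (hpsh : StrictlyPsh D J u) {p : E n} (hp : p ∈ D) (v : E n) :
    ENNReal.ofReal (1 / √(256 * Real.exp 7 * (16384 * Real.exp 7) ^ 2) * √(lambda0 D J u) *
      (‖v‖ / √|u p|)) ≤ kobayashi D J p v := by
  set Q : ℝ := 256 * Real.exp 7 * (16384 * Real.exp 7) ^ 2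
  have hQ0 : 0 < Q := by positivity
  have hl : 0 < lambda0 D J u := hpsh
  have hup : 0 < |u p| := abs_pos.2 (hneg p hp).ne
  refine le_sInf ?_
  rintro _ ⟨α, hα, rfl, h, hh, rfl, hv⟩
  refine ENNReal.ofReal_le_ofReal ?_
  have h1 := hh.norm_sq_le hJ hD1 hJc hu hneg hpsh
  rw [hv, norm_smul, norm_inv, Real.norm_of_nonneg hα.le] at h1
  have h2 : α⁻¹ * ‖v‖ ≤ √Q * (√|u (h 0)| / √(lambda0 D J u)) := by
    rw [← Real.sqrt_div (abs_nonneg _), ← Real.sqrt_mul hQ0.le]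
    exact Real.le_sqrt_of_sq_le h1
  have h4 : 0 < √Q := Real.sqrt_pos.2 hQ0
  have h5 : 0 < √(lambda0 D J u) := Real.sqrt_pos.2 hl
  have h6 : 0 < √|u (h 0)| := Real.sqrt_pos.2 hup
  calc _ = α * (1 / √Q * √(lambda0 D J u) / √|u (h 0)| * (α⁻¹ * ‖v‖)) := by field_simp
    _ ≤ α * (1 / √Q * √(lambda0 D J u) / √|u (h 0)| *
        (√Q * (√|u (h 0)| / √(lambda0 D J u)))) := by gcongr
    _ = α := by field_simp

end Gradient

end AlmostComplex

end

theorem proposition3p3 :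
    ∃ c' : ℝ, 0 < c' ∧ ∃ ε' : ℝ, 0 < ε' ∧
      ∀ (n : ℕ) (D : Set (AlmostComplex.E n))
        (J : AlmostComplex.E n → (AlmostComplex.E n →L[ℝ] AlmostComplex.E n))
        (u : AlmostComplex.E n → ℝ),
        IsOpen D → IsConnected D → D ⊆ Metric.ball 0 1 →
        AlmostComplex.IsAlmostComplexOn J D →
        AlmostComplex.normC1 D (fun x => J x - AlmostComplex.Jst n) ≤ ε' →
        AlmostComplex.ContDiffOnClosure 2 u D →
        (∀ x ∈ D, u x < 0) →
        AlmostComplex.StrictlyPsh D J u →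
        ∀ t : ℝ, (∀ x ∈ D, ‖x‖ ≤ t) →
          ∀ p ∈ D, ∀ v : AlmostComplex.E n,
            ENNReal.ofReal
                (c' * Real.exp (-2 * t) * √(AlmostComplex.lambda0 D J u) * (‖v‖ / √|u p|)) ≤
              AlmostComplex.kobayashi D J p v := by
  refine ⟨1 / √(256 * Real.exp 7 * (16384 * Real.exp 7) ^ 2), by positivity,
    1 / 100, by norm_num, ?_⟩
  intro n D J u hD _ hDb hJ hε hu hneg hpsh t ht p hp v
  have hbdd : Bornology.IsBounded D := Metric.isBounded_ball.subset hDb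
  have hN : AlmostComplex.IsNearlyStandardOn J D :=
    ⟨hD, hJ.contDiff.1, hJ.sq_eq, fun x hx => AlmostComplex.norm_sub_Jst_le hD hbdd hJ hε hx,
      fun x hx => AlmostComplex.norm_fderiv_le hD hbdd hJ hε hx⟩
  refine le_trans (ENNReal.ofReal_le_ofReal ?_) (hN.ofReal_le_kobayashi
    (fun x hx => (mem_ball_zero_iff.1 (hDb hx)).le) hJ hu hneg hpsh hp v)
  -- Evaluating the bound by `t` at `p` gives `t ≥ 0`.
  have h : Real.exp (-2 * t) ≤ 1 := by
    have := (norm_nonneg _).trans (ht _ hp)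
    exact Real.exp_le_one_iff.2 (by linarith)
  gcongr
  exact mul_le_of_le_one_right (by positivity) h
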